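/- Theorem (Liouville's theorem). Let $(M,g)$ be a $C^\infty$ Lorentzian manifold of dimension $n=1+d$ with signature $(-,+,\dots,+)$, let $F$ be a smooth closed two-form on $M$ (the external electromagnetic field; $F=0$ is allowed), $q\in\mathbb{R}$ and $m>0$. On the tangent bundle $\pi:TM\to M$ consider the Poincaré one-form $\Theta_{(x,p)}(X)=g_x(p,\pi_*X)$, the symplectic form $\Omega_s=d\Theta+q\,\pi^*F$ (which is $d(\Theta+q\,\pi^*A)$ wherever $F=dA$), the volume form $$\Lambda=\frac{(-1)^{n(n-1)/2}}{n!}\,\underbrace{\Omega_s\wedge\dots\wedge\Omega_s}_{n},$$ the Hamiltonian $H(x,p)=\tfrac12 g_x(p,p)$, and the Liouville vector field $L$, defined by $dH=\Omega_s(\cdot,L)$. Let $\Gamma_m=H^{-1}(-m^2/2)=\{(x,p)\in TM: g_x(p,p)=-m^2\}$ be the mass shell, a $(2n-1)$-dimensional embedded submanifold of $TM$ to which $L$ is tangent, with inclusion $\iota:\Gamma_m\to TM$. There exist smooth $(2n-1)$-forms $\sigma$ on $V=\{H<0\}\subset TM$ with $dH\wedge\sigma=\Lambda$ on $V$, and for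 every such $\sigma$ the form $\Omega:=\iota^*\sigma$ is a volume form on $\Gamma_m$ which is invariant under the Liouville vector field: $$\pounds_L\Omega=(\operatorname{div}_\Omega L)\,\Omega=0 ,$$ so that $\operatorname{div}_\Omega L=0$. -/

import Mathlib

open Set Filter Bundle
open scoped Manifold ContDiff Topology

noncomputable section
namespace RelativisticKinetic

section Algebra
variable {V : Type*} [AddCommGroup V] [Module ℝ V] [TopologicalSpace V]

/-- Tensor product of alternating forms: `(α ⊗ β)(v₁, …, v_{k+l}) = α(v₁, …, v_k) β(v_{k+1}, …, v_{k+l})`. -/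
def tensor {k l : ℕ} (α : V [⋀^Fin k]→L[ℝ] ℝ) (β : V [⋀^Fin l]→L[ℝ] ℝ) :
    ContinuousMultilinearMap ℝ (fun _ : Fin (k + l) => V) ℝ where
  toMultilinearMap := ((LinearMap.mul' ℝ ℝ).compMultilinearMap
    (α.toMultilinearMap.domCoprod β.toMultilinearMap)).domDomCongr finSumFinEquiv
  cont := by
    have h1 : Continuous fun v : Fin (k + l) → V => fun i => v (Fin.castAdd l i) := by fun_prop
    have h2 : Continuous fun v : Fin (k + l) → V => fun j => v (Fin.natAdd k j) := by fun_prop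
    exact (α.cont.comp h1).mul (β.cont.comp h2)

theorem tensor_apply {k l : ℕ} (α : V [⋀^Fin k]→L[ℝ] ℝ) (β : V [⋀^Fin l]→L[ℝ] ℝ)
    (v : Fin (k + l) → V) :
    tensor α β v = α (fun i => v (Fin.castAdd l i)) * β (fun j => v (Fin.natAdd k j)) := rfl

/-- Wedge product, `α ∧ β = (k! l!)⁻¹ ∑_π sign π (α ⊗ β) ∘ π`; thus
`(α ∧ β)(u, v) = α u * β v - α v * β u` for one-forms. -/
def wedge {k l : ℕ} (α : V [⋀^Fin k]→L[ℝ] ℝ) (β : V [⋀^Fin l]→L[ℝ] ℝ) :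
    V [⋀^Fin (k + l)]→L[ℝ] ℝ :=
  ((k.factorial : ℝ) * l.factorial)⁻¹ • ContinuousMultilinearMap.alternatization (tensor α β)

/-- The `n`-fold wedge product `η ∧ ⋯ ∧ η` of a two-form (`1` for `n = 0`). -/
def wedgePow (η : V [⋀^Fin 2]→L[ℝ] ℝ) : (n : ℕ) → V [⋀^Fin (2 * n)]→L[ℝ] ℝ
  | 0 => ContinuousAlternatingMap.constOfIsEmpty ℝ V (Fin 0) (1 : ℝ)
  | n + 1 => wedge (wedgePow η n) η

end Algebra

section Forms
variable {E : Type*} [NormedAddCommGroup E] [NormedSpace ℝ E] {H : Type*} [TopologicalSpace H]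
  (I : ModelWithCorners ℝ E H) {N : Type*} [TopologicalSpace N] [ChartedSpace H N]

variable (N) in
/-- Differential `k`-forms on a manifold (smoothness is the predicate `SmoothFormAt`). -/
abbrev DiffForm (k : ℕ) : Type _ := ∀ x : N, TangentSpace I x [⋀^Fin k]→L[ℝ] ℝ

variable {I} in
/-- A field of covectors, seen as a form of degree one. -/
def oneForm (θ : ∀ x : N, TangentSpace I x →L[ℝ] ℝ) : DiffForm I N 1 := fun x =>
  ContinuousAlternatingMap.ofSubsingleton ℝ (TangentSpace I x) ℝ (0 : Fin 1) (θ x)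

/-- The differential `df` of a function. -/
def differential (f : N → ℝ) (x : N) : TangentSpace I x →L[ℝ] ℝ := mfderiv I 𝓘(ℝ, ℝ) f x

/-- The form `η` in the preferred chart at `x₀`, i.e. its pull-back by the inverse chart.
This and the following notions are meant for manifolds without boundary. -/
def formInChart {k : ℕ} (η : DiffForm I N k) (x₀ : N) (y : E) : E [⋀^Fin k]→L[ℝ] ℝ :=
  (η ((extChartAt I x₀).symm y)).compContinuousLinearMap
    (mfderiv 𝓘(ℝ, E) I (extChartAt I x₀).symm y)

/-- The vector field `X` in the preferred chart at `x₀`. -/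
def fieldInChart (X : ∀ x : N, TangentSpace I x) (x₀ : N) (y : E) : E :=
  VectorField.mpullback 𝓘(ℝ, E) I (extChartAt I x₀).symm X y

/-- `η` is `C^∞` at `x`: its components in the chart at `x` are. -/
def SmoothFormAt {k : ℕ} (η : DiffForm I N k) (x : N) : Prop :=
  ContDiffAt ℝ ∞ (formInChart I η x) (extChartAt I x x)

/-- The exterior derivative, computed in the chart at the point. -/
def exteriorDeriv {k : ℕ} (η : DiffForm I N k) : DiffForm I N (k + 1) := fun x =>
  (extDeriv (formInChart I η x) (extChartAt I x x)).compContinuousLinearMap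
    (mfderiv I 𝓘(ℝ, E) (extChartAt I x) x)

/-- The Lie derivative `£_X η`. In the chart at the point it has the usual components
`(£_X η)(v₁, …, v_k) = (D_X η)(v₁, …, v_k) + ∑ᵢ η(v₁, …, DX(vᵢ), …, v_k)`. -/
def lieDeriv {k : ℕ} (X : ∀ x : N, TangentSpace I x) (η : DiffForm I N k) : DiffForm I N k :=
  fun x =>
    let y : E := extChartAt I x x
    let η' : E → E [⋀^Fin k]→L[ℝ] ℝ := formInChart I η x
    let X' : E → E := fieldInChart I X x
    (fderiv ℝ η' y (X' y) + (η' y).fderivCompContinuousLinearMap (.id ℝ E) (fderiv ℝ X' y)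
      ).compContinuousLinearMap (mfderiv I 𝓘(ℝ, E) (extChartAt I x) x)

variable {E' : Type*} [NormedAddCommGroup E'] [NormedSpace ℝ E'] {H' : Type*} [TopologicalSpace H']
  (I' : ModelWithCorners ℝ E' H') {N' : Type*} [TopologicalSpace N'] [ChartedSpace H' N']

/-- The pull-back `f^* η`. -/
def pullbackForm {k : ℕ} (f : N → N') (η : DiffForm I' N' k) : DiffForm I N k := fun x =>
  (η (f x)).compContinuousLinearMap (mfderiv I I' f x)

/-- A volume form (for `k` the dimension of the manifold): smooth and nowhere zero. -/
def IsVolumeForm {k : ℕ} (η : DiffForm I N k) : Prop := ∀ x, SmoothFormAt I η x ∧ η x ≠ 0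

/-- The divergence of `X` relative to a volume form `η`: the number with `£_X η = (div_η X) η`. -/
def divergence {k : ℕ} (X : ∀ x : N, TangentSpace I x) (η : DiffForm I N k) (x : N) : ℝ :=
  Classical.epsilon fun c => lieDeriv I X η x = c • η x

end Forms
section LevelSet
variable {E : Type*} [NormedAddCommGroup E] [NormedSpace ℝ E] {H : Type*} [TopologicalSpace H]
  (I : ModelWithCorners ℝ E H) {N : Type*} [TopologicalSpace N] [ChartedSpace H N]

/-- A diffeomorphism from an open subset of `N` to an open subset of `ℝ × ℝᵏ` whose first
component is `f`; its restriction to `f = c` is a chart of the level set. -/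
structure IsStraightening (f : N → ℝ) {k : ℕ}
    (Φ : OpenPartialHomeomorph N (ℝ × EuclideanSpace ℝ (Fin k))) : Prop where
  contMDiffOn : ContMDiffOn I 𝓘(ℝ, ℝ × EuclideanSpace ℝ (Fin k)) ∞ Φ Φ.source
  contMDiffOn_symm : ContMDiffOn 𝓘(ℝ, ℝ × EuclideanSpace ℝ (Fin k)) I ∞ Φ.symm Φ.target
  fst_eq : ∀ u ∈ Φ.source, (Φ u).1 = f u

theorem exists_complement [FiniteDimensional ℝ E] {k : ℕ} (hk : Module.finrank ℝ E = k + 1)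
    (ℓ : E →L[ℝ] ℝ) (hℓ : ℓ ≠ 0) :
    ∃ (P : E →L[ℝ] EuclideanSpace ℝ (Fin k)) (e : E ≃L[ℝ] ℝ × EuclideanSpace ℝ (Fin k)),
      (e : E →L[ℝ] ℝ × EuclideanSpace ℝ (Fin k)) = ℓ.prod P := by
  have hℓ' : (ℓ : E →ₗ[ℝ] ℝ) ≠ 0 := fun h => hℓ (by ext x; exact LinearMap.congr_fun h x)
  have hker : Module.finrank ℝ (LinearMap.ker (ℓ : E →ₗ[ℝ] ℝ)) = k := by
    have := Module.Dual.finrank_ker_add_one_of_ne_zero hℓ'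
    omega
  obtain ⟨pr, hpr⟩ := LinearMap.exists_leftInverse_of_injective
    (LinearMap.ker (ℓ : E →ₗ[ℝ] ℝ)).subtype (by simp)
  let j : LinearMap.ker (ℓ : E →ₗ[ℝ] ℝ) ≃ₗ[ℝ] EuclideanSpace ℝ (Fin k) :=
    LinearEquiv.ofFinrankEq _ _ (by simp [hker])
  let P : E →L[ℝ] EuclideanSpace ℝ (Fin k) := LinearMap.toContinuousLinearMap (j.toLinearMap ∘ₗ pr)
  have hinj : Function.Injective (ℓ.prod P).toLinearMap := by
    rw [← LinearMap.ker_eq_bot, LinearMap.ker_eq_bot']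
    intro v hv
    have h1 : ℓ v = 0 := congrArg Prod.fst hv
    have h2 : j (pr v) = 0 := congrArg Prod.snd hv
    have h3 : pr v = 0 := by simpa using h2
    have h4 := LinearMap.congr_fun hpr ⟨v, h1⟩
    simp only [LinearMap.comp_apply, Submodule.subtype_apply, LinearMap.id_apply] at h4
    rw [h3] at h4
    exact (congrArg Subtype.val h4).symm
  refine ⟨P, (LinearEquiv.ofInjectiveOfFinrankEq _ hinj (by simp [hk]; omega)).toContinuousLinearEquiv, ?_⟩
  ext v <;> rfl

theorem exists_straightening [I.Boundaryless] [IsManifold I ∞ N] [FiniteDimensional ℝ E] {k : ℕ}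
    (hk : Module.finrank ℝ E = k + 1) {f : N → ℝ} (hf : ContMDiff I 𝓘(ℝ, ℝ) ∞ f) {x : N}
    (hx : mfderiv I 𝓘(ℝ, ℝ) f x ≠ 0) :
    ∃ Φ : OpenPartialHomeomorph N (ℝ × EuclideanSpace ℝ (Fin k)),
      IsStraightening I f Φ ∧ x ∈ Φ.source := by
  let φ : OpenPartialHomeomorph N E :=
    (chartAt H x).trans I.toHomeomorph.toOpenPartialHomeomorph
  have hφ : ContMDiffOn I 𝓘(ℝ, E) ∞ φ φ.source := by
    have : φ.source = (chartAt H x).source := by simp [φ]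
    rw [this]
    exact contMDiffOn_extChartAt
  have hφt : φ.target = (extChartAt I x).target := by
    simp [φ, I.range_eq_univ]
    rfl
  have hφs : ContMDiffOn 𝓘(ℝ, E) I ∞ φ.symm φ.target := by
    rw [hφt]
    exact contMDiffOn_extChartAt_symm x
  have hxs : x ∈ φ.source := by simp [φ]
  let h : E → ℝ := f ∘ φ.symm
  have hh : ContDiffOn ℝ ∞ h φ.target :=
    contMDiffOn_iff_contDiffOn.1 (hf.comp_contMDiffOn hφs)
  have hℓ : fderiv ℝ h (φ x) ≠ 0 := by
    intro h0
    apply hx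
    have h2 : fderivWithin ℝ h (range I) (φ x) = 0 := by
      rw [I.range_eq_univ, fderivWithin_univ, h0]
    exact (hf.mdifferentiable (by simp) x).mfderiv.trans h2
  obtain ⟨P, e, he⟩ := exists_complement hk _ hℓ
  let Ψ : E → ℝ × EuclideanSpace ℝ (Fin k) := fun y => (h y, P y)
  have hΨ : ContDiffOn ℝ ∞ Ψ φ.target := hh.prodMk P.contDiff.contDiffOn
  have hxt : φ x ∈ φ.target := φ.map_source hxs
  have hΨd : HasFDerivAt Ψ (e : E →L[ℝ] ℝ × EuclideanSpace ℝ (Fin k)) (φ x) := by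
    rw [he]
    exact (((hh.contDiffAt (φ.open_target.mem_nhds hxt)).differentiableAt
      (by simp)).hasFDerivAt).prodMk P.hasFDerivAt
  have hΨa : ContDiffAt ℝ ∞ Ψ (φ x) := hΨ.contDiffAt (φ.open_target.mem_nhds hxt)
  have h1 : (∞ : WithTop ℕ∞) ≠ 0 := by simp
  let s : Set E := φ.target ∩ fderiv ℝ Ψ ⁻¹'
    (range ((↑) : (E ≃L[ℝ] ℝ × EuclideanSpace ℝ (Fin k)) → E →L[ℝ] ℝ × EuclideanSpace ℝ (Fin k)))
  have hs : IsOpen s :=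
    (hΨ.continuousOn_fderiv_of_isOpen φ.open_target (by simp)).isOpen_inter_preimage
      φ.open_target ContinuousLinearEquiv.isOpen
  let ψ := (hΨa.toOpenPartialHomeomorph Ψ hΨd h1).restrOpen s hs
  have hψ : (ψ : E → _) = Ψ := rfl
  have hψs : ψ.source ⊆ s := fun y hy => by
    simp only [ψ, OpenPartialHomeomorph.restrOpen_source] at hy; exact hy.2
  have hψsm : ContDiffOn ℝ ∞ ψ.symm ψ.target := by
    intro z hz
    have hy : ψ.symm z ∈ s := hψs (ψ.map_target hz)
    obtain ⟨e', he'⟩ := hy.2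
    have hc : ContDiffAt ℝ ∞ Ψ (ψ.symm z) := hΨ.contDiffAt (φ.open_target.mem_nhds hy.1)
    refine (ψ.contDiffAt_symm hz (f₀' := e') ?_ hc).contDiffWithinAt
    rw [he']
    exact (hc.differentiableAt h1).hasFDerivAt
  refine ⟨φ.trans ψ, ⟨?_, ?_, ?_⟩, ?_⟩
  · have : ContMDiffOn 𝓘(ℝ, E) 𝓘(ℝ, ℝ × EuclideanSpace ℝ (Fin k)) ∞ ψ ψ.source :=
      contMDiffOn_iff_contDiffOn.2 (hΨ.mono fun y hy => (hψs hy).1)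
    exact this.comp (hφ.mono fun u hu => hu.1) fun u hu => hu.2
  · have : ContMDiffOn 𝓘(ℝ, ℝ × EuclideanSpace ℝ (Fin k)) 𝓘(ℝ, E) ∞ ψ.symm ψ.target :=
      contMDiffOn_iff_contDiffOn.2 hψsm
    exact hφs.comp (this.mono fun u hu => hu.1) fun u hu => hu.2
  · intro u hu
    change f (φ.symm (φ u)) = f u
    rw [φ.left_inv hu.1]
  · refine ⟨hxs, ?_⟩
    change φ x ∈ ψ.source
    simp only [ψ, OpenPartialHomeomorph.restrOpen_source]
    exact ⟨hΨa.mem_toOpenPartialHomeomorph_source hΨd h1, hxt, ⟨e, hΨd.fderiv.symm⟩⟩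

variable {I}

open Classical in
/-- The chart of the level set `f = c` obtained from a straightening `Φ`, given by the second
component of `Φ`. The point `s₀` only provides values of the inverse off the target. -/
def levelChart {f : N → ℝ} {c : ℝ} {k : ℕ} (s₀ : {u : N // f u = c})
    (Φ : OpenPartialHomeomorph N (ℝ × EuclideanSpace ℝ (Fin k))) (hΦ : IsStraightening I f Φ) :
    OpenPartialHomeomorph {u : N // f u = c} (EuclideanSpace ℝ (Fin k)) where
  toFun s := (Φ s.1).2
  invFun y := if h : f (Φ.symm (c, y)) = c then ⟨Φ.symm (c, y), h⟩ else s₀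
  source := {s | s.1 ∈ Φ.source}
  target := {y | (c, y) ∈ Φ.target}
  map_source' s hs := by
    have : (c, (Φ s.1).2) = Φ s.1 := Prod.ext ((hΦ.fst_eq _ hs).trans s.2).symm rfl
    simp only [mem_ofPred_eq, this]
    exact Φ.map_source hs
  map_target' y hy := by
    have h : f (Φ.symm (c, y)) = c := by
      rw [← hΦ.fst_eq _ (Φ.map_target hy), Φ.right_inv hy]
    simp only [mem_ofPred_eq, dif_pos h]
    exact Φ.map_target hy
  left_inv' s hs := by
    have h1 : (c, (Φ s.1).2) = Φ s.1 := Prod.ext ((hΦ.fst_eq _ hs).trans s.2).symm rfl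
    have h2 : Φ.symm (c, (Φ s.1).2) = s.1 := by rw [h1, Φ.left_inv hs]
    have h : f (Φ.symm (c, (Φ s.1).2)) = c := by rw [h2, s.2]
    rw [dif_pos h]
    exact Subtype.ext h2
  right_inv' y hy := by
    have h : f (Φ.symm (c, y)) = c := by
      rw [← hΦ.fst_eq _ (Φ.map_target hy), Φ.right_inv hy]
    simp only [dif_pos h, Φ.right_inv hy]
  open_source := Φ.open_source.preimage continuous_subtype_val
  open_target := Φ.open_target.preimage (by fun_prop)
  continuousOn_toFun := continuous_snd.comp_continuousOn
    (Φ.continuousOn.comp continuous_subtype_val.continuousOn fun _ hs => hs)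
  continuousOn_invFun := by
    refine (Topology.IsInducing.subtypeVal.continuousOn_iff (f := fun y =>
      if h : f (Φ.symm (c, y)) = c then (⟨Φ.symm (c, y), h⟩ : {u : N // f u = c}) else s₀)).2 ?_
    refine (Φ.symm.continuousOn.comp (f := fun y => (c, y)) (by fun_prop)
      (fun y hy => hy)).congr fun y hy => ?_
    have h : f (Φ.symm (c, y)) = c := by
      rw [← hΦ.fst_eq _ (Φ.map_target hy), Φ.right_inv hy]
    simp only [Function.comp_apply, dif_pos h]

variable (I) in
/-- The manifold structure of a regular level set: the charts are the slices of the
straightenings, so that the level set is an embedded submanifold. -/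
abbrev levelSetChartedSpace [I.Boundaryless] [IsManifold I ∞ N] [FiniteDimensional ℝ E] {k : ℕ}
    (hk : Module.finrank ℝ E = k + 1) {f : N → ℝ} (hf : ContMDiff I 𝓘(ℝ, ℝ) ∞ f) {c : ℝ}
    (hc : ∀ x, f x = c → mfderiv I 𝓘(ℝ, ℝ) f x ≠ 0) :
    ChartedSpace (EuclideanSpace ℝ (Fin k)) {u : N // f u = c} where
  atlas := {e | ∃ s₀ Φ, ∃ hΦ : IsStraightening I f Φ, e = levelChart s₀ Φ hΦ}
  chartAt s := levelChart s (exists_straightening I hk hf (hc s.1 s.2)).choose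
    (exists_straightening I hk hf (hc s.1 s.2)).choose_spec.1
  mem_chart_source s := (exists_straightening I hk hf (hc s.1 s.2)).choose_spec.2
  chart_mem_atlas s := ⟨s, _, _, rfl⟩

theorem levelSet_isManifold [I.Boundaryless] [IsManifold I ∞ N] [FiniteDimensional ℝ E] {k : ℕ}
    (hk : Module.finrank ℝ E = k + 1) {f : N → ℝ} (hf : ContMDiff I 𝓘(ℝ, ℝ) ∞ f) {c : ℝ}
    (hc : ∀ x, f x = c → mfderiv I 𝓘(ℝ, ℝ) f x ≠ 0) :
    letI := levelSetChartedSpace I hk hf hc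
    IsManifold 𝓘(ℝ, EuclideanSpace ℝ (Fin k)) ∞ {u : N // f u = c} := by
  let _ := levelSetChartedSpace I hk hf hc
  refine isManifold_of_contDiffOn _ _ _ ?_
  rintro _ _ ⟨s₁, Φ₁, h₁, rfl⟩ ⟨s₂, Φ₂, h₂, rfl⟩
  have key : ContMDiffOn 𝓘(ℝ, ℝ × EuclideanSpace ℝ (Fin k)) 𝓘(ℝ, ℝ × EuclideanSpace ℝ (Fin k)) ∞
      (Φ₂ ∘ Φ₁.symm) (Φ₁.target ∩ Φ₁.symm ⁻¹' Φ₂.source) :=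
    h₂.contMDiffOn.comp (h₁.contMDiffOn_symm.mono inter_subset_left) fun _ h => h.2
  have key' := contMDiffOn_iff_contDiffOn.1 key
  have h3 : ∀ y, (c, y) ∈ Φ₁.target →
      ((levelChart s₁ Φ₁ h₁).symm y : N) = Φ₁.symm (c, y) := fun y hy => by
    have h : f (Φ₁.symm (c, y)) = c := by
      rw [← h₁.fst_eq _ (Φ₁.map_target hy), Φ₁.right_inv hy]
    simp [levelChart, dif_pos h]
  have h4 : ContDiffOn ℝ ∞ (fun y => ((Φ₂ ∘ Φ₁.symm) (c, y)).2)
      {y | (c, y) ∈ Φ₁.target ∩ Φ₁.symm ⁻¹' Φ₂.source} :=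
    contDiff_snd.comp_contDiffOn (key'.comp (by fun_prop) fun _ h => h)
  simp only [modelWithCornersSelf_coe, modelWithCornersSelf_coe_symm, range_id, inter_univ,
    preimage_id_eq, id_eq, Function.id_comp, Function.comp_id]
  refine (h4.congr_mono ?_ ?_)
  · intro y hy
    change (Φ₂ ((levelChart s₁ Φ₁ h₁).symm y : N)).2 = _
    rw [h3 y hy.1]; rfl
  · intro y hy
    refine ⟨hy.1, ?_⟩
    have h5 : ((levelChart s₁ Φ₁ h₁).symm y : N) ∈ Φ₂.source := hy.2
    rwa [h3 y hy.1] at h5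

end LevelSet

section Kinetic
/-- The model space of a spacetime of dimension `n = d + 1`. -/
abbrev Coord (d : ℕ) : Type := EuclideanSpace ℝ (Fin (d + 1))
/-- The model of the tangent bundle (adapted coordinates `(x, p)`). -/
abbrev tangentModel (d : ℕ) := (𝓘(ℝ, Coord d)).tangent

variable {d : ℕ} {M : Type*} [TopologicalSpace M] [ChartedSpace (Coord d) M]
  [IsManifold 𝓘(ℝ, Coord d) ∞ M]

variable (d M) in
/-- A `C^∞` Lorentzian metric of signature `(-, +, …, +)`. -/
structure LorentzMetric where
  form (x : M) : TangentSpace 𝓘(ℝ, Coord d) x →L[ℝ] TangentSpace 𝓘(ℝ, Coord d) x →L[ℝ] ℝ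
  symm (x : M) (v w : TangentSpace 𝓘(ℝ, Coord d) x) : form x v w = form x w v
  signature (x : M) : ∃ b : Module.Basis (Fin (d + 1)) ℝ (TangentSpace 𝓘(ℝ, Coord d) x),
    ∀ i j, form x (b i) (b j) = if i = j then (if i = 0 then -1 else 1) else 0
  contMDiff : ContMDiff 𝓘(ℝ, Coord d) (𝓘(ℝ, Coord d).prod 𝓘(ℝ, Coord d →L[ℝ] Coord d →L[ℝ] ℝ)) ∞
    (fun x => TotalSpace.mk' (Coord d →L[ℝ] Coord d →L[ℝ] ℝ)
      (E := fun x : M => TangentSpace 𝓘(ℝ, Coord d) x →L[ℝ] TangentSpace 𝓘(ℝ, Coord d) x →L[ℝ] ℝ)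
      x (form x))

variable (d M) in
/-- The tangent bundle; `v.proj` is the event `x` and `v.snd` the momentum `p`. -/
abbrev TM : Type _ := TangentBundle 𝓘(ℝ, Coord d) M

/-- The projection `π : TM → M`. -/
def footpoint (v : TM d M) : M := v.proj

/-- The push-forward `π_*` at `v`. -/
def footpointDeriv (v : TM d M) :
    TangentSpace (tangentModel d) v →L[ℝ] TangentSpace 𝓘(ℝ, Coord d) v.proj :=
  mfderiv (tangentModel d) 𝓘(ℝ, Coord d) footpoint v

/-- The Poincaré one-form `Θ_(x,p)(X) = g_x(p, π_* X)`. -/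
def poincareForm (g : LorentzMetric d M) : DiffForm (tangentModel d) (TM d M) 1 :=
  oneForm fun v => (g.form v.proj v.snd).comp (footpointDeriv v)

/-- The symplectic form `Ω_s = dΘ + q π^*F` in an external field `F`. Wherever `F = dA` this is
`d(Θ + q π^*A)`, and it is `dΘ` for uncharged particles (`q = 0`). -/
def symplecticForm (g : LorentzMetric d M) (q : ℝ) (F : DiffForm 𝓘(ℝ, Coord d) M 2) :
    DiffForm (tangentModel d) (TM d M) 2 := fun v =>
  exteriorDeriv (tangentModel d) (poincareForm g) v +
    q • pullbackForm (tangentModel d) 𝓘(ℝ, Coord d) footpoint F v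

/-- The volume form `Λ = (-1)^(n(n-1)/2) / n! Ω_s ∧ ⋯ ∧ Ω_s` (`n` factors), `n = d + 1`. -/
def phaseVolume (g : LorentzMetric d M) (q : ℝ) (F : DiffForm 𝓘(ℝ, Coord d) M 2) :
    DiffForm (tangentModel d) (TM d M) (2 * (d + 1)) := fun v =>
  ((-1 : ℝ) ^ ((d + 1) * d / 2) / (d + 1).factorial) • wedgePow (symplecticForm g q F v) (d + 1)

/-- `H(x, p) = g_x(p, p) / 2`. -/
def hamiltonian (g : LorentzMetric d M) (v : TM d M) : ℝ :=
  (1 / 2) * g.form v.proj v.snd v.snd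

/-- The Liouville vector field: the `L` with `dH = Ω_s(·, L)`. -/
def liouvilleField (g : LorentzMetric d M) (q : ℝ) (F : DiffForm 𝓘(ℝ, Coord d) M 2) (v : TM d M) :
    TangentSpace (tangentModel d) v :=
  Classical.epsilon fun w => ∀ u : TangentSpace (tangentModel d) v,
    differential (tangentModel d) (hamiltonian g) v u = symplecticForm g q F v ![u, w]

theorem contMDiff_hamiltonian (g : LorentzMetric d M) :
    ContMDiff (tangentModel d) 𝓘(ℝ, ℝ) ∞ (hamiltonian g) := by
  intro v
  have hv : ContMDiff (tangentModel d) (tangentModel d) ∞ (fun u : TM d M => u) := contMDiff_id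
  have hp : ContMDiff (tangentModel d) 𝓘(ℝ, Coord d) ∞ (fun u : TM d M => u.proj) :=
    contMDiff_proj _
  have : ContMDiffAt (tangentModel d) (𝓘(ℝ, Coord d).prod 𝓘(ℝ)) ∞
      (fun u : TM d M => TotalSpace.mk' ℝ (E := Bundle.Trivial M ℝ) u.proj
        (g.form u.proj u.snd u.snd)) v := by
    apply ContMDiffAt.clm_bundle_apply₂ (F₁ := Coord d) (F₂ := Coord d)
    · exact g.contMDiff.contMDiffAt.comp v hp.contMDiffAt
    · exact hv v
    · exact hv v
  rw [contMDiffAt_totalSpace] at this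
  exact contMDiffAt_const.mul this.2

theorem mfderiv_hamiltonian_ne_zero (g : LorentzMetric d M) (v : TM d M)
    (hv : hamiltonian g v ≠ 0) : mfderiv (tangentModel d) 𝓘(ℝ, ℝ) (hamiltonian g) v ≠ 0 := by
  intro h0
  let c : ℝ → TM d M := fun t => ⟨v.proj, (1 + t) • v.snd⟩
  have hc : ContMDiffAt 𝓘(ℝ, ℝ) (tangentModel d) ∞ c 0 := by
    rw [contMDiffAt_totalSpace]
    refine ⟨contMDiffAt_const, ?_⟩
    let e := trivializationAt (Coord d) (TangentSpace 𝓘(ℝ, Coord d) : M → Type _) v.proj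
    have : (fun t => (e (c t)).2) = fun t => (1 + t) • (e v).2 := by
      ext1 t
      have := (e.linear ℝ (FiberBundle.mem_baseSet_trivializationAt' v.proj)).map_smul (1 + t) v.snd
      exact this
    change ContMDiffAt _ _ _ (fun t => (e (c t)).2) 0
    rw [this]
    apply ContDiffAt.contMDiffAt
    fun_prop
  have hc0 : c 0 = v := by simp [c]
  have h1 : HasMFDerivAt (tangentModel d) 𝓘(ℝ, ℝ) (hamiltonian g) (c 0) 0 := by
    rw [hc0, ← h0]
    exact ((contMDiff_hamiltonian g).mdifferentiable (by simp) v).hasMFDerivAt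
  have h2 := h1.comp 0 (hc.mdifferentiableAt (by simp)).hasMFDerivAt
  rw [ContinuousLinearMap.zero_comp] at h2
  have h3 : HasDerivAt (hamiltonian g ∘ c) 0 0 := by
    have h2' : HasFDerivAt (hamiltonian g ∘ c) (0 : ℝ →L[ℝ] ℝ) 0 := h2.hasFDerivAt
    simpa using h2'.hasDerivAt
  have h4 : hamiltonian g ∘ c = fun t => (1 + t) ^ 2 * hamiltonian g v := by
    ext t
    simp [hamiltonian, c]
    ring
  have h5 : HasDerivAt (fun t : ℝ => (1 + t) ^ 2 * hamiltonian g v) (2 * hamiltonian g v) 0 := by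
    have := (((hasDerivAt_id (0 : ℝ)).const_add 1).pow 2).mul_const (hamiltonian g v)
    simpa using this
  rw [h4] at h3
  have := h5.unique h3
  exact hv (by linarith)

/-- The mass shell `Γ_m = {H = -m²/2} ⊆ TM`, with the subspace topology and, below, its structure
of embedded submanifold of dimension `2n - 1 = 2d + 1`. -/
def MassShell (g : LorentzMetric d M) (m : ℝ) : Type _ :=
  {v : TM d M // hamiltonian g v = -m ^ 2 / 2}

namespace MassShell
variable (g : LorentzMetric d M) (m : ℝ)

/-- The inclusion `ι : Γ_m → TM`. -/
def incl (s : MassShell g m) : TM d M := s.1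

instance : TopologicalSpace (MassShell g m) := instTopologicalSpaceSubtype

theorem regular [hm : Fact (0 < m)] (v : TM d M) (hv : hamiltonian g v = -m ^ 2 / 2) :
    mfderiv (tangentModel d) 𝓘(ℝ, ℝ) (hamiltonian g) v ≠ 0 :=
  mfderiv_hamiltonian_ne_zero g v (by rw [hv]; have := pow_pos hm.out 2; linarith)

theorem finrank_model : Module.finrank ℝ (Coord d × Coord d) = (2 * d + 1) + 1 := by
  simp; ring

instance [Fact (0 < m)] :
    ChartedSpace (EuclideanSpace ℝ (Fin (2 * d + 1))) (MassShell g m) :=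
  levelSetChartedSpace (tangentModel d) finrank_model (contMDiff_hamiltonian g) (regular g m)

instance [Fact (0 < m)] :
    IsManifold 𝓘(ℝ, EuclideanSpace ℝ (Fin (2 * d + 1))) ∞ (MassShell g m) :=
  levelSet_isManifold finrank_model (contMDiff_hamiltonian g) (regular g m)

end MassShell

/-- The model of the mass shell. -/
abbrev shellModel (d : ℕ) := 𝓘(ℝ, EuclideanSpace ℝ (Fin (2 * d + 1)))

variable (g : LorentzMetric d M) (m : ℝ) [Fact (0 < m)]

/-- The form `Ω = ι^*σ` on the mass shell. -/
def shellForm (σ : DiffForm (tangentModel d) (TM d M) (2 * d + 1)) :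
    DiffForm (shellModel d) (MassShell g m) (2 * d + 1) :=
  pullbackForm (shellModel d) (tangentModel d) (MassShell.incl g m) σ

/-- The Liouville vector field as a vector field on `Γ_m`: the `w` with `ι_* w = L`. -/
def shellField (q : ℝ) (F : DiffForm 𝓘(ℝ, Coord d) M 2) (s : MassShell g m) :
    TangentSpace (shellModel d) s :=
  Classical.epsilon fun w =>
    mfderiv (shellModel d) (tangentModel d) (MassShell.incl g m) s w =
      liouvilleField g q F (MassShell.incl g m s)


/-- `σ` is a smooth `(2n-1)`-form on `V = {H < 0}` with `dH ∧ σ = Λ` there. (Its values off `V`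
are irrelevant.) -/
structure IsShellFactor (g : LorentzMetric d M) (q : ℝ) (F : DiffForm 𝓘(ℝ, Coord d) M 2)
    (σ : DiffForm (tangentModel d) (TM d M) (2 * d + 1)) : Prop where
  smooth : ∀ v, hamiltonian g v < 0 → SmoothFormAt (tangentModel d) σ v
  wedge_eq : ∀ v, hamiltonian g v < 0 →
    ∀ X : Fin (1 + (2 * d + 1)) → TangentSpace (tangentModel d) v,
      wedge (oneForm (differential (tangentModel d) (hamiltonian g)) v) (σ v) X =
        phaseVolume g q F v (X ∘ Fin.cast (by omega))

end Kinetic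
end RelativisticKinetic
end

open RelativisticKinetic

/-! Near a point of the shell take coordinates (h, y) on TM with h = H (a straightening); the slices
h = -m²/2 are the charts of Γ_m. Since Ω_s is closed and Ω_s(·, L) = dH, Cartan's formula gives £_L
Ω_s = 0, hence £_L Λ = 0 (`IsStraightening.hasDerivAt_volumeAlong`). Antisymmetry gives dH(L) =
Ω_s(L, L) = 0, so L is tangent to the slices. Evaluating dH ∧ σ = Λ on ∂_h followed by slice vectors
shows that ι^*σ is the contraction of Λ with ∂_h, restricted to the slice, whatever σ is
(`IsShellFactor.formAlong_slice`). The linearised flow of L sends ∂_h to ∂_h plus a slice vector,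
and Λ vanishes on 2n slice vectors because a slice has dimension 2n - 1. So the invariance of Λ
passes to Ω (`lieDeriv_slice_eq_zero`).

In adapted coordinates (x, p), Ω_s is the metric pairing of dp with dx plus a term in dx alone
(`isPhaseForm_symplecticForm`). This yields both nondegeneracy, which makes L well defined and
smooth, and an explicit Darboux frame, on which the expansion of the n-th power has only nonnegative
terms and one equal to 1. Thus Λ, and with it Ω, vanishes nowhere.

A factor σ exists because H is quadratic in p: by Euler's identity Y = (2H)⁻¹ p ∂/∂p satisfies dH(Y)
= 1 on V, and then σ = ι_Y Λ works (`wedge_oneForm_interior`).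

No flow is integrated. The Lie derivative is the derivative at t = 0 of η at y + t L on the vectors
v_i + t DL(v_i) (`hasDerivAt_form_curve`), so the Leibniz rule and the passage to slices become
statements about functions of one real variable. -/

noncomputable section
namespace RelativisticKinetic

/-! ### Wedge products as sums over permutations -/

section ExteriorAlgebra
variable {V : Type*} [AddCommGroup V] [Module ℝ V] [TopologicalSpace V]

theorem wedge_apply {k l : ℕ} (α : V [⋀^Fin k]→L[ℝ] ℝ) (β : V [⋀^Fin l]→L[ℝ] ℝ)
    (v : Fin (k + l) → V) :
    wedge α β v = ((k.factorial : ℝ) * l.factorial)⁻¹ * ∑ ρ : Equiv.Perm (Fin (k + l)),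
      (Equiv.Perm.sign ρ : ℝ) * (α (fun i => v (ρ (Fin.castAdd l i))) *
        β (fun j => v (ρ (Fin.natAdd k j)))) := by
  simp only [wedge, ContinuousAlternatingMap.smul_apply, smul_eq_mul,
    ContinuousMultilinearMap.alternatization_apply_apply, tensor_apply, Function.comp,
    Units.smul_def, zsmul_eq_mul]

/-- A permutation of the first `k` of `k + l` indices. -/
def extendPerm {k : ℕ} (l : ℕ) (τ : Equiv.Perm (Fin k)) : Equiv.Perm (Fin (k + l)) :=
  finSumFinEquiv.permCongr (Equiv.Perm.sumCongr τ 1)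

theorem extendPerm_castAdd {k l : ℕ} (τ : Equiv.Perm (Fin k)) (i : Fin k) :
    extendPerm l τ (Fin.castAdd l i) = Fin.castAdd l (τ i) := by
  simp [extendPerm, Equiv.permCongr_apply]

theorem extendPerm_natAdd {k l : ℕ} (τ : Equiv.Perm (Fin k)) (i : Fin l) :
    extendPerm l τ (Fin.natAdd k i) = Fin.natAdd k i := by
  simp [extendPerm, Equiv.permCongr_apply]

theorem sign_extendPerm {k l : ℕ} (τ : Equiv.Perm (Fin k)) :
    Equiv.Perm.sign (extendPerm l τ) = Equiv.Perm.sign τ := by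
  simp [extendPerm, Equiv.Perm.sign_permCongr, Equiv.Perm.sign_sumCongr]

theorem sign_mul_sign_self {ι : Type*} [Fintype ι] [DecidableEq ι] (τ : Equiv.Perm ι) :
    ((Equiv.Perm.sign τ : ℤ) : ℝ) * (Equiv.Perm.sign τ : ℤ) = 1 := by
  rw [← Int.cast_mul, ← Units.val_mul, Int.units_mul_self]; simp

/-- Antisymmetrising in the first `k` arguments first only contributes a factor `k!`. -/
theorem sum_sign_sum_sign {W : Type*} {k l : ℕ} (f : (Fin k → W) → ℝ) (h : (Fin l → W) → ℝ)
    (v : Fin (k + l) → W) :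
    ∑ ρ : Equiv.Perm (Fin (k + l)), (Equiv.Perm.sign ρ : ℝ) *
      ((∑ τ : Equiv.Perm (Fin k), (Equiv.Perm.sign τ : ℝ) *
        f (fun i => v (ρ (Fin.castAdd l (τ i))))) * h (fun j => v (ρ (Fin.natAdd k j)))) =
    k.factorial * ∑ ρ : Equiv.Perm (Fin (k + l)), (Equiv.Perm.sign ρ : ℝ) *
      (f (fun i => v (ρ (Fin.castAdd l i))) * h (fun j => v (ρ (Fin.natAdd k j)))) := by
  simp only [Finset.sum_mul, Finset.mul_sum]
  rw [Finset.sum_comm]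
  have key : ∀ τ : Equiv.Perm (Fin k), ∑ ρ : Equiv.Perm (Fin (k + l)), (Equiv.Perm.sign ρ : ℝ) *
      ((Equiv.Perm.sign τ : ℝ) * f (fun i => v (ρ (Fin.castAdd l (τ i)))) *
        h (fun j => v (ρ (Fin.natAdd k j)))) =
      ∑ ρ : Equiv.Perm (Fin (k + l)), (Equiv.Perm.sign ρ : ℝ) *
      (f (fun i => v (ρ (Fin.castAdd l i))) * h (fun j => v (ρ (Fin.natAdd k j)))) := by
    intro τ
    -- Substituting ρ ∘ (τ ⊕ 1) for ρ absorbs τ and its sign, so all k! inner terms give the same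
    -- sum.
    refine Fintype.sum_equiv (Equiv.mulRight (extendPerm l τ)) _ _ fun ρ => ?_
    simp only [Equiv.coe_mulRight, Equiv.Perm.mul_apply, extendPerm_castAdd, extendPerm_natAdd,
      Equiv.Perm.sign_mul, sign_extendPerm, Units.val_mul, Int.cast_mul]
    ring
  rw [Finset.sum_congr rfl fun τ _ => key τ]
  simp [Finset.mul_sum, Fintype.card_perm]

/-- The two indices `2 i + s`, `s = 0, 1`, of the `i`-th pair. -/
def pairIndex {n : ℕ} (i : Fin n) (s : Fin 2) : Fin (2 * n) :=
  ⟨2 * i + s, by omega⟩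

/-- Each wedge brings the factor 1/((2n)! 2!), and antisymmetrising the already antisymmetrised
first 2n slots gives back (2n)!, so one factor 1/2 survives per step. All later facts about Λ are
read off this expansion. -/
theorem wedgePow_apply (η : V [⋀^Fin 2]→L[ℝ] ℝ) (n : ℕ) (v : Fin (2 * n) → V) :
    wedgePow η n v = ((2 : ℝ) ^ n)⁻¹ * ∑ ρ : Equiv.Perm (Fin (2 * n)),
      (Equiv.Perm.sign ρ : ℝ) * ∏ i : Fin n, η (fun s => v (ρ (pairIndex i s))) := by
  induction n with
  | zero =>
    simp only [wedgePow, ContinuousAlternatingMap.constOfIsEmpty_apply]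
    have : Subsingleton (Equiv.Perm (Fin (2 * 0))) :=
      inferInstanceAs (Subsingleton (Equiv.Perm (Fin 0)))
    rw [Fintype.sum_subsingleton _ (1 : Equiv.Perm (Fin (2 * 0)))]
    simp
  | succ n ih =>
    have h := wedge_apply (wedgePow η n) η v
    have h2 := sum_sign_sum_sign (k := 2 * n) (l := 2)
      (fun w => ∏ i : Fin n, η (fun s => w (pairIndex i s))) η v
    change wedge (wedgePow η n) η v = _
    rw [h]
    simp only [ih, mul_assoc]
    have h3 : ∀ ρ : Equiv.Perm (Fin (2 * n + 2)),
        (∏ i : Fin n, η (fun s => v (ρ (Fin.castAdd 2 (pairIndex i s))))) *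
          η (fun j => v (ρ (Fin.natAdd (2 * n) j))) =
        ∏ i : Fin (n + 1), η (fun s => v (ρ (pairIndex i s))) := fun ρ => by
      rw [Fin.prod_univ_castSucc]; rfl
    simp only [h3] at h2
    simp only [mul_left_comm _ ((2 : ℝ) ^ n)⁻¹, ← Finset.mul_sum]
    rw [h2]
    change _ = _ * ∑ ρ : Equiv.Perm (Fin (2 * n + 2)), _
    have : ((2 * n).factorial : ℝ) ≠ 0 := by positivity
    simp only [Nat.factorial_two, Nat.cast_ofNat, pow_succ]
    field_simp

theorem wedgePow_comp {V' : Type*} [AddCommGroup V'] [Module ℝ V'] [TopologicalSpace V']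
    (η : V [⋀^Fin 2]→L[ℝ] ℝ) (n : ℕ) (D : V' →L[ℝ] V) (v : Fin (2 * n) → V') :
    wedgePow (η.compContinuousLinearMap D) n v = wedgePow η n (fun i => D (v i)) := by
  simp only [wedgePow_apply]; rfl

/-- Only permutations fixing the first index survive, since α kills the other vectors. There are k!
of them, all contributing equally because β is alternating, which cancels the normalisation. -/
theorem wedge_oneForm_apply {k : ℕ} (α : V →L[ℝ] ℝ) (β : V [⋀^Fin k]→L[ℝ] ℝ)
    (v : Fin (1 + k) → V) (hv : ∀ i : Fin k, α (v (Fin.natAdd 1 i)) = 0) :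
    wedge (ContinuousAlternatingMap.ofSubsingleton ℝ V ℝ (0 : Fin 1) α) β v =
      α (v (Fin.castAdd k 0)) * β (fun i => v (Fin.natAdd 1 i)) := by
  rw [wedge_apply]
  let c : Fin (k + 1) ≃ Fin (1 + k) := finCongr (add_comm k 1)
  have hc0 : c 0 = Fin.castAdd k 0 := rfl
  have hcs : ∀ i : Fin k, c i.succ = Fin.natAdd 1 i := fun i => by ext; simp [c, add_comm]
  have h1 : ∑ ρ : Equiv.Perm (Fin (1 + k)), (Equiv.Perm.sign ρ : ℝ) *
      (α (v (ρ (Fin.castAdd k 0))) * β (fun j => v (ρ (Fin.natAdd 1 j)))) =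
      ∑ ρ : Equiv.Perm (Fin (k + 1)), (Equiv.Perm.sign ρ : ℝ) *
      (α (v (c (ρ 0))) * β (fun j => v (c (ρ j.succ)))) := by
    refine (Fintype.sum_equiv c.permCongr _ _ fun ρ => ?_).symm
    simp [Equiv.permCongr_apply, Equiv.Perm.sign_permCongr, ← hc0, ← hcs]
  have h2 : ∑ ρ : Equiv.Perm (Fin (k + 1)), (Equiv.Perm.sign ρ : ℝ) *
      (α (v (c (ρ 0))) * β (fun j => v (c (ρ j.succ)))) =
      k.factorial * (α (v (c 0)) * β (fun j => v (c j.succ))) := by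
    -- Split a permutation into the image of 0 and a permutation of the remaining k indices; only
    -- the image 0 contributes.
    rw [← Equiv.sum_comp (Equiv.Perm.decomposeFin (n := k)).symm, Fintype.sum_prod_type,
      Finset.sum_eq_single 0]
    · have : ∀ e : Equiv.Perm (Fin k), ((Equiv.Perm.sign e : ℤ) : ℝ) *
          (α (v (c 0)) * β (fun j => v (c (e j).succ))) =
          α (v (c 0)) * β (fun j => v (c j.succ)) := by
        intro e
        have := β.toAlternatingMap.map_perm (fun j => v (c j.succ)) e
        have h3 : β (fun j => v (c (e j).succ)) =
            (Equiv.Perm.sign e : ℤ) * β (fun j => v (c j.succ)) := by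
          simpa [Function.comp_def, Units.smul_def] using this
        rw [h3]
        linear_combination (α (v (c 0)) * β (fun j => v (c j.succ))) * sign_mul_sign_self e
      simp [this, Fintype.card_perm]
    · intro p _ hp
      obtain ⟨q, rfl⟩ := Fin.exists_succ_eq.2 hp
      refine Finset.sum_eq_zero fun e _ => ?_
      have : α (v (c ((Equiv.Perm.decomposeFin.symm (q.succ, e)) 0))) = 0 := by
        rw [Equiv.Perm.decomposeFin_symm_apply_zero, hcs, hv]
      rw [this]; simp
    · simp
  have h0 : ∀ ρ : Equiv.Perm (Fin (1 + k)),
      (ContinuousAlternatingMap.ofSubsingleton ℝ V ℝ (0 : Fin 1) α)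
        (fun i => v (ρ (Fin.castAdd k i))) = α (v (ρ (Fin.castAdd k 0))) := fun ρ => by simp
  simp only [h0]
  rw [h1, h2, hc0]
  simp only [hcs]
  have : (k.factorial : ℝ) ≠ 0 := by positivity
  simp only [Nat.factorial_one, Nat.cast_one, one_mul]
  field_simp

/-- V is the direct sum of the line through Y and the kernel of α. Such a basis is what top-degree
forms are tested on below. -/
theorem exists_basis_cons {V : Type*} [AddCommGroup V] [Module ℝ V] [FiniteDimensional ℝ V]
    {k : ℕ} (hk : Module.finrank ℝ V = k + 1)
    (α : V →ₗ[ℝ] ℝ) (Y : V) (hY : α Y = 1) :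
    ∃ (B : Module.Basis (Fin (k + 1)) ℝ V) (w : Fin k → V),
      (∀ i, α (w i) = 0) ∧ ⇑B = (Fin.cons Y w : Fin (k + 1) → V) := by
  have hα : α ≠ 0 := fun h => by simp [h] at hY
  have hker : Module.finrank ℝ (LinearMap.ker α) = k := by
    have := Module.Dual.finrank_ker_add_one_of_ne_zero hα
    omega
  let b := Module.finBasisOfFinrankEq ℝ _ hker
  refine ⟨Module.Basis.mkFinCons Y b (fun c x hx h => ?_) (fun z => ⟨-α z, by simp [hY]⟩),
    fun i => b i, fun i => (b i).2, Module.Basis.coe_mkFinCons ..⟩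
  have h1 : α x = 0 := hx
  have h2 := congrArg α h
  simpa [h1, hY] using h2

/-- In top degree `α ∧ ι_Y λ = λ` if `α(Y) = 1`. -/
theorem wedge_oneForm_interior [FiniteDimensional ℝ V] {k : ℕ}
    (hk : Module.finrank ℝ V = k + 1) (α : V →L[ℝ] ℝ) (Y : V) (hY : α Y = 1)
    (β : V [⋀^Fin k]→L[ℝ] ℝ) (μ : V [⋀^Fin (k + 1)]→L[ℝ] ℝ)
    (hβ : ∀ v, β v = μ (Fin.cons Y v : Fin (k + 1) → V)) (v : Fin (1 + k) → V) :
    wedge (ContinuousAlternatingMap.ofSubsingleton ℝ V ℝ (0 : Fin 1) α) β v =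
      μ (v ∘ Fin.cast (add_comm k 1)) := by
  obtain ⟨b, w, hw, hb⟩ := exists_basis_cons hk α.toLinearMap Y hY
  let B : Module.Basis (Fin (1 + k)) ℝ V := b.reindex (finCongr (add_comm k 1))
  let f := (wedge (ContinuousAlternatingMap.ofSubsingleton ℝ V ℝ (0 : Fin 1) α) β).toAlternatingMap
  let g := μ.toAlternatingMap.domDomCongr (finCongr (add_comm k 1))
  have hB0 : B (Fin.castAdd k 0) = Y := by
    have : (finCongr (add_comm k 1)).symm (Fin.castAdd k 0) = 0 := rfl
    simp only [B, Module.Basis.reindex_apply, this, hb, Fin.cons_zero]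
  have hBs : ∀ i, B (Fin.natAdd 1 i) = w i := fun i => by
    have : (finCongr (add_comm k 1)).symm (Fin.natAdd 1 i) = i.succ := by ext; simp
    simp only [B, Module.Basis.reindex_apply, this, hb, Fin.cons_succ]
  have hfg : f B = g B := by
    change wedge _ β B = μ (B ∘ finCongr (add_comm k 1))
    have hBb : B ∘ finCongr (add_comm k 1) = b := by
      ext1 i
      simp [B]
    rw [wedge_oneForm_apply α β B (fun i => by rw [hBs]; exact hw i), hB0, hY, one_mul, hβ, hBb, hb]
    simp only [hBs]
  -- Both forms have top degree, hence are multiples of the determinant of B and are determined by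
  -- their value on B.
  have h : f = g := by
    rw [f.eq_smul_basis_det B, g.eq_smul_basis_det B, hfg]
  exact congrArg (fun F : V [⋀^Fin (1 + k)]→ₗ[ℝ] ℝ => F v) h

end ExteriorAlgebra

/-! ### Nonvanishing of the top power in a Darboux frame -/

section Darboux
variable {V : Type*} [AddCommGroup V] [Module ℝ V] [TopologicalSpace V]

theorem form_swap (η : V [⋀^Fin 2]→L[ℝ] ℝ) (a b : V) : η ![a, b] = -η ![b, a] := by
  have := η.toAlternatingMap.map_swap ![b, a] (i := 0) (j := 1) (by decide)
  have h : ![b, a] ∘ Equiv.swap (0 : Fin 2) 1 = ![a, b] := by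
    ext i; fin_cases i <;> simp
  rw [h] at this
  exact this

theorem perm_fin_two (ε : Equiv.Perm (Fin 2)) : ε = 1 ∨ ε = Equiv.swap 0 1 := by
  revert ε; decide

/-- For a Darboux frame all nonzero terms of the expansion of `η ∧ ⋯ ∧ η` are positive. -/
theorem darboux_term_nonneg (η : V [⋀^Fin 2]→L[ℝ] ℝ) {n : ℕ} (w : Fin n × Fin 2 → V)
    (h1 : ∀ i, η ![w (i, 0), w (i, 1)] = 1)
    (h0 : ∀ i j s t, i ≠ j → η ![w (i, s), w (j, t)] = 0) (ρ : Equiv.Perm (Fin n × Fin 2)) :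
    0 ≤ (Equiv.Perm.sign ρ : ℝ) * ∏ i : Fin n, η (fun s => w (ρ (i, s))) := by
  have hη : ∀ i, η (fun s => w (ρ (i, s))) = η ![w (ρ (i, 0)), w (ρ (i, 1))] := fun i => by
    congr 1; ext s; fin_cases s <;> rfl
  -- If ρ maps pairs to pairs, it permutes the pairs by some τ after flips ε i inside them. Its sign
  -- is (sign τ)² ∏ sign (ε i), and each flip sign cancels against the sign of the matching factor
  -- of η. Otherwise some pair is split and its factor is zero.
  by_cases h : ∀ i, (ρ (i, 0)).1 = (ρ (i, 1)).1
  · let t : Fin n → Fin n := fun i => (ρ (i, 0)).1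
    have ht : ∀ i s, (ρ (i, s)).1 = t i := fun i s => by
      fin_cases s
      · rfl
      · exact (h i).symm
    have hsurj : Function.Surjective t := fun j => by
      obtain ⟨⟨i, s⟩, hi⟩ := ρ.surjective (j, 0)
      exact ⟨i, by rw [← ht i s, hi]⟩
    let τ : Equiv.Perm (Fin n) := Equiv.ofBijective t (Finite.injective_iff_bijective.1
      (Finite.injective_iff_surjective.2 hsurj))
    have he : ∀ i, Function.Injective fun s => (ρ (i, s)).2 := fun i s s' hs => by
      have : ρ (i, s) = ρ (i, s') := Prod.ext (by rw [ht, ht]) hs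
      simpa using this
    let ε : Fin n → Equiv.Perm (Fin 2) := fun i =>
      Equiv.ofBijective _ (Finite.injective_iff_bijective.1 (he i))
    have hρ : ρ = Equiv.prodCongrLeft (fun _ : Fin 2 => τ) * Equiv.prodCongrRight ε := by
      ext1 ⟨i, s⟩
      exact Prod.ext (ht i s) rfl
    have hs : (Equiv.Perm.sign ρ : ℝ) = ∏ i, (Equiv.Perm.sign (ε i) : ℝ) := by
      rw [hρ, Equiv.Perm.sign_mul, Equiv.Perm.sign_prodCongrLeft, Equiv.Perm.sign_prodCongrRight]
      have := sign_mul_sign_self τ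
      simp only [Finset.prod_const, Finset.card_univ, Fintype.card_fin, Units.val_mul, pow_two,
        Int.cast_mul, this, one_mul, Units.coe_prod, Int.cast_prod]
    rw [hs, ← Finset.prod_mul_distrib]
    refine Finset.prod_nonneg fun i _ => ?_
    have hi : ∀ s, ρ (i, s) = (t i, ε i s) := fun s => Prod.ext (ht i s) rfl
    rw [hη, hi, hi]
    rcases perm_fin_two (ε i) with h | h
    · rw [h]; simp [h1]
    · rw [h, form_swap]; simp [h1]
  · push Not at h
    obtain ⟨i, hi⟩ := h
    rw [Finset.prod_eq_zero (Finset.mem_univ i), mul_zero]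
    rw [hη]
    exact h0 _ _ _ _ hi

/-- Evaluated on the frame e₀, f₀, e₁, f₁, …, every term of the expansion is nonnegative and the
identity permutation contributes 1, so the sum is positive. -/
theorem wedgePow_ne_zero_of_darboux (η : V [⋀^Fin 2]→L[ℝ] ℝ) {n : ℕ} (e f : Fin n → V)
    (hee : ∀ i j, η ![e i, e j] = 0) (hff : ∀ i j, η ![f i, f j] = 0)
    (hef : ∀ i j, η ![e i, f j] = if i = j then 1 else 0) : wedgePow η n ≠ 0 := by
  let w : Fin n × Fin 2 → V := fun p => ![e p.1, f p.1] p.2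
  let P : Fin n × Fin 2 ≃ Fin (2 * n) := finProdFinEquiv.trans (finCongr (mul_comm n 2))
  have hP : ∀ i s, pairIndex i s = P (i, s) := fun i s => by
    ext; simp [P, pairIndex, add_comm]
  have hw1 : ∀ i, η ![w (i, 0), w (i, 1)] = 1 := fun i => by simp [w, hef]
  have hw0 : ∀ i j s t, i ≠ j → η ![w (i, s), w (j, t)] = 0 := fun i j s t hij => by
    fin_cases s <;> fin_cases t <;> simp [w, hee, hff, hef, hij]
    all_goals rw [form_swap, hef, if_neg hij.symm, neg_zero]
  intro h
  have h2 : wedgePow η n (w ∘ P.symm) = 0 := by rw [h]; rfl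
  rw [wedgePow_apply] at h2
  have h3 : ∑ ρ : Equiv.Perm (Fin (2 * n)), (Equiv.Perm.sign ρ : ℝ) *
      ∏ i : Fin n, η (fun s => (w ∘ P.symm) (ρ (pairIndex i s))) =
      ∑ ρ : Equiv.Perm (Fin n × Fin 2), (Equiv.Perm.sign ρ : ℝ) *
      ∏ i : Fin n, η (fun s => w (ρ (i, s))) := by
    refine (Fintype.sum_equiv P.permCongr _ _ fun ρ => ?_).symm
    simp [Equiv.permCongr_apply, Equiv.Perm.sign_permCongr, hP]
  have h4 := Finset.single_le_sum (fun ρ _ => darboux_term_nonneg η w hw1 hw0 ρ)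
    (Finset.mem_univ (1 : Equiv.Perm (Fin n × Fin 2)))
  have h5 : ∀ i, η (fun s => w (i, s)) = 1 := fun i => by
    rw [← hw1 i]; congr 1
  simp only [Equiv.Perm.sign_one, Equiv.Perm.one_apply, h5, Finset.prod_const_one, Units.val_one,
    Int.cast_one, mul_one] at h4
  rw [← h3] at h4
  have h6 : (0 : ℝ) < ((2 : ℝ) ^ n)⁻¹ := by positivity
  have := mul_pos h6 (lt_of_lt_of_le one_pos h4)
  exact this.ne' h2

end Darboux

/-! ### Smooth dependence of forms on parameters -/

section Smooth
variable {E : Type*} [NormedAddCommGroup E] [NormedSpace ℝ E]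
  {F : Type*} [NormedAddCommGroup F] [NormedSpace ℝ F] {n : WithTop ℕ∞}

variable (F) in
/-- Evaluation of forms on basis vectors. -/
def evalBasis [FiniteDimensional ℝ F] (k : ℕ) :
    (F [⋀^Fin k]→L[ℝ] ℝ) →ₗ[ℝ] ((Fin k → Fin (Module.finrank ℝ F)) → ℝ) where
  toFun μ s := μ fun i => Module.finBasis ℝ F (s i)
  map_add' _ _ := rfl
  map_smul' _ _ := rfl

theorem evalBasis_injective [FiniteDimensional ℝ F] (k : ℕ) :
    Function.Injective (evalBasis F k) := fun μ ν hμν => by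
  apply ContinuousAlternatingMap.toAlternatingMap_injective
  exact (Module.finBasis ℝ F).ext_alternating fun s _ => congrFun hμν s

variable (F) in
theorem finiteDimensional_form [FiniteDimensional ℝ F] (k : ℕ) :
    FiniteDimensional ℝ (F [⋀^Fin k]→L[ℝ] ℝ) :=
  Module.Finite.of_injective _ (evalBasis_injective k)

/-- A form on F is a linear function of its finitely many components in a basis, through a left
inverse of `evalBasis`; a linear map on a finite-dimensional space is smooth. -/
theorem contDiffAt_form_of_apply [FiniteDimensional ℝ F] {k : ℕ} {η : E → F [⋀^Fin k]→L[ℝ] ℝ}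
    {x : E} (h : ∀ v, ContDiffAt ℝ n (fun y => η y v) x) : ContDiffAt ℝ n η x := by
  obtain ⟨r, hr⟩ := LinearMap.exists_leftInverse_of_injective (evalBasis F k)
    (LinearMap.ker_eq_bot.2 (evalBasis_injective k))
  have h1 : ContDiffAt ℝ n (fun y => evalBasis F k (η y)) x := contDiffAt_pi.2 fun s => h _
  have h2 : η = fun y => LinearMap.toContinuousLinearMap r (evalBasis F k (η y)) := by
    ext1 y; exact (LinearMap.congr_fun hr (η y)).symm
  rw [h2]
  exact (LinearMap.toContinuousLinearMap r).contDiff.contDiffAt.comp x h1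

/-- Induction on the degree: currying in the first slot is continuous linear, so one variable
argument is inserted at a time. -/
theorem contDiffAt_form_apply {k : ℕ} {η : E → F [⋀^Fin k]→L[ℝ] ℝ} {v : Fin k → E → F} {x : E}
    (hη : ContDiffAt ℝ n η x) (hv : ∀ i, ContDiffAt ℝ n (v i) x) :
    ContDiffAt ℝ n (fun y => η y fun i => v i y) x := by
  induction k with
  | zero =>
    have : (fun y => η y fun i => v i y) = fun y =>
        ContinuousAlternatingMap.apply ℝ F ℝ (0 : Fin 0 → F) (η y) := by
      ext1 y
      rw [ContinuousAlternatingMap.apply_apply]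
      congr 1
      exact Subsingleton.elim _ _
    rw [this]
    exact (ContinuousLinearMap.contDiff _).contDiffAt.comp x hη
  | succ k ih =>
    let c : (F [⋀^Fin (k + 1)]→L[ℝ] ℝ) →L[ℝ] (F →L[ℝ] F [⋀^Fin k]→L[ℝ] ℝ) :=
      (ContinuousAlternatingMap.curryLeftLI (𝕜 := ℝ) (E := F) (F := ℝ)
        (n := k)).toContinuousLinearMap
    have hc : ContDiff ℝ n c := by apply ContinuousLinearMap.contDiff
    have h1 : ContDiffAt ℝ n (fun y => (η y).curryLeft (v 0 y)) x := by
      have : ContDiffAt ℝ n (fun y => (η y).curryLeft) x :=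
        hc.contDiffAt.comp x hη
      exact this.clm_apply (hv 0)
    have h2 := ih h1 (v := fun i => v i.succ) fun i => hv i.succ
    refine h2.congr_of_eventuallyEq (Eventually.of_forall fun y => ?_)
    change η y _ = η y (Matrix.vecCons _ _)
    congr 1
    ext i
    refine Fin.cases ?_ (fun j => ?_) i <;> simp

theorem contDiffAt_form_comp {D : Type*} [NormedAddCommGroup D] [NormedSpace ℝ D]
    [FiniteDimensional ℝ D] {k : ℕ} {η : E → F [⋀^Fin k]→L[ℝ] ℝ} {A : E → D →L[ℝ] F} {x : E}
    (hη : ContDiffAt ℝ n η x) (hA : ContDiffAt ℝ n A x) :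
    ContDiffAt ℝ n (fun y => (η y).compContinuousLinearMap (A y)) x :=
  contDiffAt_form_of_apply fun v => contDiffAt_form_apply hη (v := fun i y => A y (v i))
    fun _ => hA.clm_apply contDiffAt_const

theorem contDiffAt_wedgePow [FiniteDimensional ℝ F] {η : E → F [⋀^Fin 2]→L[ℝ] ℝ} {x : E}
    (hη : ContDiffAt ℝ n η x) (k : ℕ) : ContDiffAt ℝ n (fun y => wedgePow (η y) k) x := by
  refine contDiffAt_form_of_apply fun v => ?_
  simp only [wedgePow_apply]
  exact contDiffAt_const.mul (ContDiffAt.sum fun ρ _ => contDiffAt_const.mul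
    (contDiffAt_prod fun i _ => contDiffAt_form_apply hη fun _ => contDiffAt_const))

end Smooth

/-! ### Lie derivatives through curves, and restriction to slices -/

section LieDerivative
variable {W : Type*} [NormedAddCommGroup W] [NormedSpace ℝ W]

/-- The Lie derivative is the derivative along the linearised flow. -/
theorem hasDerivAt_form_curve {k : ℕ} {η : W → W [⋀^Fin k]→L[ℝ] ℝ} {y : W}
    (hη : DifferentiableAt ℝ η y) (A : W →L[ℝ] W) (w : W) (v : Fin k → W) :
    HasDerivAt (fun t : ℝ => η (y + t • w) fun i => v i + t • A (v i))
      ((fderiv ℝ η y w + (η y).fderivCompContinuousLinearMap (.id ℝ W) A) v) 0 := by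
  have h1 : HasDerivAt (fun t : ℝ => y + t • w) w 0 := by
    simpa using ((hasDerivAt_id (0 : ℝ)).smul_const w).const_add y
  have h2 : HasFDerivAt (fun t : ℝ => η (y + t • w))
      ((fderiv ℝ η y).comp ((1 : ℝ →L[ℝ] ℝ).smulRight w)) 0 := by
    refine HasFDerivAt.comp (0 : ℝ) (g := η) (f := fun t : ℝ => y + t • w) ?_ h1.hasFDerivAt
    simpa using hη.hasFDerivAt
  have h3 : HasDerivAt (fun t : ℝ => ContinuousLinearMap.id ℝ W + t • A) A 0 := by
    simpa using ((hasDerivAt_id (0 : ℝ)).smul_const A).const_add (ContinuousLinearMap.id ℝ W)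
  have h4 := h2.continuousAlternatingMapCompContinuousLinearMap h3.hasFDerivAt
  have h5 := (h4.continuousAlternatingMap_apply_const v).hasDerivAt
  refine HasDerivAt.congr_deriv (f := fun t : ℝ => η (y + t • w) fun i => v i + t • A (v i)) h5 ?_
  simp

/-- `£_L Ω = d(ι_L Ω) = 0` if `Ω` is closed and `Ω(·, L)` is constant. -/
theorem hasDerivAt_closed_form_curve {Ω : W → W [⋀^Fin 2]→L[ℝ] ℝ} {L : W → W} {y : W}
    (hΩ : DifferentiableAt ℝ Ω y) (hd : extDeriv Ω y = 0) (hL : DifferentiableAt ℝ L y)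
    {ℓ : W → ℝ} (h : ∀ᶠ z in 𝓝 y, ∀ u, Ω z ![u, L z] = ℓ u) (v : Fin 2 → W) :
    HasDerivAt (fun t : ℝ => Ω (y + t • L y) fun i => v i + t • fderiv ℝ L y (v i)) 0 0 := by
  have h0 := hasDerivAt_form_curve hΩ (fderiv ℝ L y) (L y) v
  -- Differentiate the constant function z ↦ Ω_z(u, L z) in the direction a.
  have key : ∀ u a, fderiv ℝ Ω y a ![u, L y] + Ω y ![u, fderiv ℝ L y a] = 0 := by
    intro u a
    have h1 : HasFDerivAt (fun z => Ω z fun i => (![fun _ => u, L] : Fin 2 → W → W) i z) _ y :=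
      hΩ.hasFDerivAt.continuousAlternatingMap_apply
      (g := ![fun _ => u, L]) (g' := ![0, fderiv ℝ L y]) (fun i => by
        fin_cases i
        · exact hasFDerivAt_const u y
        · exact hL.hasFDerivAt)
    have e : ∀ z, (fun i => (![fun _ => u, L] : Fin 2 → W → W) i z) = ![u, L z] := fun z => by
      ext i; fin_cases i <;> rfl
    simp only [e] at h1
    have h2 : HasFDerivAt (fun z => Ω z ![u, L z]) (0 : W →L[ℝ] ℝ) y :=
      (hasFDerivAt_const (ℓ u) y).congr_of_eventuallyEq (h.mono fun z hz => hz u)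
    have h3 := congrArg (fun F : W →L[ℝ] ℝ => F a) (h1.unique h2)
    have e1 : Function.update ![u, L y] 1 (fderiv ℝ L y a) = ![u, fderiv ℝ L y a] := by
      ext i; fin_cases i <;> rfl
    simpa [Fin.sum_univ_two, e1] using h3
  have hcl : ∀ a b c, fderiv ℝ Ω y a ![b, c] - fderiv ℝ Ω y b ![a, c] +
      fderiv ℝ Ω y c ![a, b] = 0 := by
    intro a b c
    have h1 : extDeriv Ω y ![a, b, c] = 0 := by rw [hd]; rfl
    rw [extDeriv, ContinuousAlternatingMap.alternatizeUncurryFin_apply] at h1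
    have e0 : (0 : Fin 3).removeNth ![a, b, c] = ![b, c] := by ext i; fin_cases i <;> rfl
    have e1 : (1 : Fin 3).removeNth ![a, b, c] = ![a, c] := by ext i; fin_cases i <;> rfl
    have e2 : (2 : Fin 3).removeNth ![a, b, c] = ![a, b] := by ext i; fin_cases i <;> rfl
    rw [Fin.sum_univ_three, e0, e1, e2] at h1
    simp at h1
    linarith
  have hv : v = ![v 0, v 1] := by ext i; fin_cases i <;> rfl
  convert h0 using 1
  rw [ContinuousAlternatingMap.add_apply, ContinuousAlternatingMap.fderivCompContinuousLinearMap_apply]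
  have e0 : (fun j => (Function.update (fun _ => ContinuousLinearMap.id ℝ W) (0 : Fin 2)
      (fderiv ℝ L y) j) (v j)) = ![fderiv ℝ L y (v 0), v 1] := by ext i; fin_cases i <;> rfl
  have e1 : (fun j => (Function.update (fun _ => ContinuousLinearMap.id ℝ W) (1 : Fin 2)
      (fderiv ℝ L y) j) (v j)) = ![v 0, fderiv ℝ L y (v 1)] := by ext i; fin_cases i <;> rfl
  rw [Fin.sum_univ_two, e0, e1]
  rw [hv]
  simp only [Matrix.cons_val_zero, Matrix.cons_val_one]
  -- Cartan's formula in coordinates: the two derivatives of Ω(·, L) and closedness on (v 0, v 1, L)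
  -- sum to the Lie derivative, up to one swap of arguments.
  have k1 := key (v 0) (v 1)
  have k2 := key (v 1) (v 0)
  have k3 := hcl (v 0) (v 1) (L y)
  have k4 := form_swap (Ω y) (fderiv ℝ L y (v 0)) (v 1)
  linarith

/-- The Leibniz rule: along the curve the power is a sum of products of values of Ω, each with
derivative zero. -/
theorem hasDerivAt_wedgePow_curve {Ω : W → W [⋀^Fin 2]→L[ℝ] ℝ} {y w : W} {A : W →L[ℝ] W}
    (h : ∀ v : Fin 2 → W, HasDerivAt (fun t : ℝ => Ω (y + t • w) fun i => v i + t • A (v i)) 0 0)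
    (n : ℕ) (v : Fin (2 * n) → W) :
    HasDerivAt (fun t : ℝ => wedgePow (Ω (y + t • w)) n fun i => v i + t • A (v i)) 0 0 := by
  simp only [wedgePow_apply]
  have h1 : ∀ ρ : Equiv.Perm (Fin (2 * n)), HasDerivAt (fun t : ℝ => ∏ i : Fin n,
      Ω (y + t • w) fun s => v (ρ (pairIndex i s)) + t • A (v (ρ (pairIndex i s)))) 0 0 := by
    intro ρ
    have := HasDerivAt.fun_finsetProd (u := Finset.univ)
      (fun i _ => h (fun s => v (ρ (pairIndex i s))))
    simpa using this
  have h2 := (HasDerivAt.fun_sum (u := Finset.univ) fun ρ _ =>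
    (h1 ρ).const_mul (Equiv.Perm.sign ρ : ℝ)).const_mul (((2 : ℝ) ^ n)⁻¹)
  simpa using h2

variable {G : Type*} [NormedAddCommGroup G] [NormedSpace ℝ G] [FiniteDimensional ℝ G]

/-- The k + 1 vectors lie in the k-dimensional subspace {0} × G, hence are linearly dependent. -/
theorem form_eq_zero_of_fst_eq_zero {k : ℕ} (hk : Module.finrank ℝ G = k)
    (μ : (ℝ × G) [⋀^Fin (k + 1)]→L[ℝ] ℝ) (v : Fin (k + 1) → ℝ × G) (hv : ∀ i, (v i).1 = 0) :
    μ v = 0 := by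
  have h1 : v = fun i => ContinuousLinearMap.inr ℝ ℝ G (v i).2 := by
    ext1 i; exact Prod.ext (hv i) rfl
  rw [h1]
  change (μ.compContinuousLinearMap (ContinuousLinearMap.inr ℝ ℝ G)).toAlternatingMap
    (fun i => (v i).2) = 0
  apply AlternatingMap.map_linearDependent
  intro h
  have := h.fintype_card_le_finrank
  simp [hk] at this

/-- A volume form invariant along `L` induces an invariant form on the slice `{c} × G`, if `L` is
tangent to the slices. -/
theorem lieDeriv_slice_eq_zero {k : ℕ} (hk : Module.finrank ℝ G = k)
    {μ : ℝ × G → (ℝ × G) [⋀^Fin (k + 1)]→L[ℝ] ℝ} {L : ℝ × G → ℝ × G} {c : ℝ} {x : G}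
    (hL : DifferentiableAt ℝ L (c, x)) (hL1 : ∀ᶠ z in 𝓝 (c, x), (L z).1 = 0)
    (hμ : ∀ v : Fin (k + 1) → ℝ × G, HasDerivAt (fun t : ℝ => μ ((c, x) + t • L (c, x))
      fun i => v i + t • fderiv ℝ L (c, x) (v i)) 0 0)
    {η : G → G [⋀^Fin k]→L[ℝ] ℝ} {X : G → G} (hη : DifferentiableAt ℝ η x)
    (hημ : ∀ᶠ z in 𝓝 x, ∀ w, η z w =
      μ (c, z) (Fin.cons ((1, 0) : ℝ × G) fun i => ((0, w i) : ℝ × G)))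
    (hX : ∀ᶠ z in 𝓝 x, X z = (L (c, z)).2) :
    fderiv ℝ η x (X x) + (η x).fderivCompContinuousLinearMap (.id ℝ G) (fderiv ℝ X x) = 0 := by
  -- The first component of L vanishes on a full neighbourhood, not only on the slice, so DL also
  -- maps the transverse direction (1, 0) into {0} × G.
  have hd1 : ∀ a, (fderiv ℝ L (c, x) a).1 = 0 := by
    have h1 : HasFDerivAt (fun z => (L z).1)
        ((ContinuousLinearMap.fst ℝ ℝ G).comp (fderiv ℝ L (c, x))) (c, x) :=
      (ContinuousLinearMap.fst ℝ ℝ G).hasFDerivAt.comp _ hL.hasFDerivAt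
    have h2 : HasFDerivAt (fun z => (L z).1) (0 : ℝ × G →L[ℝ] ℝ) (c, x) :=
      (hasFDerivAt_const (0 : ℝ) (c, x)).congr_of_eventuallyEq hL1
    exact fun a => congrArg (fun F : ℝ × G →L[ℝ] ℝ => F a) (h1.unique h2)
  have hA : ∀ w, fderiv ℝ L (c, x) (0, w) = (0, fderiv ℝ X x w) := by
    intro w
    have h1 : HasFDerivAt (fun z : G => (c, z)) (ContinuousLinearMap.inr ℝ ℝ G) x :=
      hasFDerivAt_prodMk_right c x
    have h2 : HasFDerivAt (fun z => (L (c, z)).2) ((ContinuousLinearMap.snd ℝ ℝ G).comp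
        ((fderiv ℝ L (c, x)).comp (ContinuousLinearMap.inr ℝ ℝ G))) x :=
      (ContinuousLinearMap.snd ℝ ℝ G).hasFDerivAt.comp x
        (HasFDerivAt.comp x (g := L) hL.hasFDerivAt h1)
    have h3 := (h2.congr_of_eventuallyEq hX).fderiv
    exact Prod.ext (hd1 _) (by rw [h3]; rfl)
  have hLx : L (c, x) = (0, X x) := Prod.ext hL1.self_of_nhds hX.self_of_nhds.symm
  ext w
  have h1 := hasDerivAt_form_curve hη (fderiv ℝ X x) (X x) w
  -- The curve on the slice, whose derivative is the Lie derivative of η, will coincide near t = 0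
  -- with the ambient curve, whose derivative is zero.
  refine h1.unique ?_
  have h2 := hμ (Fin.cons ((1, 0) : ℝ × G) fun i => ((0, w i) : ℝ × G))
  have hcont : Tendsto (fun t : ℝ => x + t • X x) (𝓝 0) (𝓝 x) := by
    have : Continuous fun t : ℝ => x + t • X x := by fun_prop
    simpa using this.tendsto 0
  refine h2.congr_of_eventuallyEq ((hcont.eventually hημ).mono fun t ht => ?_)
  have e1 : ((c, x) : ℝ × G) + t • L (c, x) = (c, x + t • X x) := by
    rw [hLx]; ext <;> simp
  change η (x + t • X x) _ = _
  rw [ht]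
  beta_reduce
  rw [e1]
  set J : Fin k → ℝ × G := fun i => (0, w i + t • fderiv ℝ X x (w i)) with hJ
  have e2 : (fun i => (Fin.cons ((1, 0) : ℝ × G) (fun i => ((0, w i) : ℝ × G)) :
        Fin (k + 1) → ℝ × G) i + t • fderiv ℝ L (c, x)
        ((Fin.cons ((1, 0) : ℝ × G) (fun i => ((0, w i) : ℝ × G)) : Fin (k + 1) → ℝ × G) i)) =
      (Fin.cons ((1, 0) + t • fderiv ℝ L (c, x) (1, 0)) J : Fin (k + 1) → ℝ × G) := by
    ext1 i
    refine Fin.cases ?_ (fun j => ?_) i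
    · simp
    · simp [hJ, hA]
  rw [e2]
  have e3 := (μ (c, x + t • X x)).toAlternatingMap.toMultilinearMap.cons_add J
    ((1, 0) : ℝ × G) (t • fderiv ℝ L (c, x) (1, 0))
  -- The drift of the transverse vector under the linearised flow is tangent to the slice, so μ does
  -- not see it.
  have e4 : μ (c, x + t • X x) (Fin.cons (t • fderiv ℝ L (c, x) (1, 0)) J) = 0 := by
    refine form_eq_zero_of_fst_eq_zero hk _ _ fun i => ?_
    refine Fin.cases ?_ (fun j => ?_) i
    · simp [hd1]
    · simp [hJ]
  have e5 : μ (c, x + t • X x) (Fin.cons ((1, 0) + t • fderiv ℝ L (c, x) (1, 0)) J) =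
    μ (c, x + t • X x) (Fin.cons (1, 0) J) +
      μ (c, x + t • X x) (Fin.cons (t • fderiv ℝ L (c, x) (1, 0)) J) := e3
  rw [e5, e4, add_zero]

end LieDerivative

/-! ### Forms in arbitrary parametrisations -/

section Pullback
variable {E : Type*} [NormedAddCommGroup E] [NormedSpace ℝ E] {H : Type*} [TopologicalSpace H]
  (I : ModelWithCorners ℝ E H) {N : Type*} [TopologicalSpace N] [ChartedSpace H N]
  {W : Type*} [NormedAddCommGroup W] [NormedSpace ℝ W]

theorem two_le_smoothness : minSmoothness ℝ 2 ≤ (∞ : WithTop ℕ∞) := by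
  rw [minSmoothness_of_isRCLikeNormedField]
  exact WithTop.coe_le_coe.2 (le_top : (2 : ℕ∞) ≤ ⊤)

/-- A form, as a function with values in the forms on the model space. -/
def formValue {k : ℕ} (η : DiffForm I N k) (x : N) : E [⋀^Fin k]→L[ℝ] ℝ := η x

/-- The derivative of a parametrisation, as a map to the model space. -/
def derivAlong (ψ : W → N) (y : W) : W →L[ℝ] E := mfderiv 𝓘(ℝ, W) I ψ y

/-- The components of a form in a parametrisation. -/
def formAlong {k : ℕ} (ψ : W → N) (η : DiffForm I N k) (y : W) : W [⋀^Fin k]→L[ℝ] ℝ :=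
  (formValue I η (ψ y)).compContinuousLinearMap (derivAlong I ψ y)

theorem formInChart_eq {k : ℕ} (η : DiffForm I N k) (x : N) :
    formInChart I η x = formAlong I (extChartAt I x).symm η := rfl

variable {I}

theorem formAlong_congr {k : ℕ} {ψ ψ' : W → N} (η : DiffForm I N k) {y : W} (h : ψ =ᶠ[𝓝 y] ψ') :
    formAlong I ψ η y = formAlong I ψ' η y := by
  have h1 : derivAlong I ψ y = derivAlong I ψ' y := h.mfderiv_eq
  rw [formAlong, formAlong, h1, h.self_of_nhds]

theorem derivAlong_comp {ψ : W → N} {W' : Type*} [NormedAddCommGroup W'] [NormedSpace ℝ W']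
    {κ : W' → W} {y : W'} (hψ : MDifferentiableAt 𝓘(ℝ, W) I ψ (κ y))
    (hκ : DifferentiableAt ℝ κ y) :
    derivAlong I (ψ ∘ κ) y = (derivAlong I ψ (κ y)).comp (fderiv ℝ κ y) := by
  have := mfderiv_comp y hψ hκ.mdifferentiableAt
  rw [mfderiv_eq_fderiv] at this
  exact this

theorem formAlong_comp {k : ℕ} (η : DiffForm I N k) {ψ : W → N} {W' : Type*}
    [NormedAddCommGroup W'] [NormedSpace ℝ W'] {κ : W' → W} {y : W'}
    (hψ : MDifferentiableAt 𝓘(ℝ, W) I ψ (κ y)) (hκ : DifferentiableAt ℝ κ y) :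
    formAlong I (ψ ∘ κ) η y = (formAlong I ψ η (κ y)).compContinuousLinearMap (fderiv ℝ κ y) := by
  rw [formAlong, derivAlong_comp hψ hκ]
  rfl

variable [IsManifold I ∞ N]

theorem contDiffAt_extChartAt_comp {ψ : W → N} {y : W} {x : N} (hx : ψ y ∈ (chartAt H x).source)
    (hψ : ContMDiffAt 𝓘(ℝ, W) I ∞ ψ y) : ContDiffAt ℝ ∞ (extChartAt I x ∘ ψ) y := by
  rw [← contMDiffAt_iff_contDiffAt]
  exact (contMDiffAt_extChartAt' hx).comp y hψ

variable [I.Boundaryless]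

theorem contMDiffAt_extChartAt_symm {x : N} {y : E} (hy : y ∈ (extChartAt I x).target) :
    ContMDiffAt 𝓘(ℝ, E) I ∞ (extChartAt I x).symm y :=
  (contMDiffOn_extChartAt_symm x).contMDiffAt ((isOpen_extChartAt_target x).mem_nhds hy)

/-- Near y, ψ is the inverse of the preferred chart at ψ y composed with a map between model spaces.
This carries smoothness and exterior derivatives, defined in that chart only, to any smooth
parametrisation. -/
theorem eventually_formAlong_eq {k : ℕ} (η : DiffForm I N k) {ψ : W → N} {y : W}
    (hψ : ∀ᶠ z in 𝓝 y, ContMDiffAt 𝓘(ℝ, W) I ∞ ψ z) : ∀ᶠ z in 𝓝 y, formAlong I ψ η z =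
      (formInChart I η (ψ y) ((extChartAt I (ψ y) ∘ ψ) z)).compContinuousLinearMap
        (fderiv ℝ (extChartAt I (ψ y) ∘ ψ) z) := by
  have h1 : ∀ᶠ z in 𝓝 y, ψ z ∈ (extChartAt I (ψ y)).source :=
    hψ.self_of_nhds.continuousAt.eventually (extChartAt_source_mem_nhds _)
  filter_upwards [h1.eventually_nhds, hψ] with z hz1 hz2
  have hz0 := hz1.self_of_nhds
  rw [extChartAt_source] at hz0
  have h3 : ψ =ᶠ[𝓝 z] (extChartAt I (ψ y)).symm ∘ (extChartAt I (ψ y) ∘ ψ) :=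
    hz1.mono fun u hu => ((extChartAt I (ψ y)).left_inv hu).symm
  rw [formAlong_congr η h3, formInChart_eq]
  refine formAlong_comp η ?_ ((contDiffAt_extChartAt_comp hz0 hz2).differentiableAt (by simp))
  exact (contMDiffAt_extChartAt_symm ((extChartAt I (ψ y)).map_source
    hz1.self_of_nhds)).mdifferentiableAt (by simp)

theorem contDiffAt_formAlong [FiniteDimensional ℝ W] {k : ℕ} {η : DiffForm I N k} {ψ : W → N}
    {y : W} (hψ : ∀ᶠ z in 𝓝 y, ContMDiffAt 𝓘(ℝ, W) I ∞ ψ z) (hη : SmoothFormAt I η (ψ y)) :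
    ContDiffAt ℝ ∞ (formAlong I ψ η) y := by
  have h := contDiffAt_extChartAt_comp (mem_chart_source H (ψ y)) hψ.self_of_nhds
  have hη' : ContDiffAt ℝ ∞ (formInChart I η (ψ y)) ((extChartAt I (ψ y) ∘ ψ) y) := hη
  refine (contDiffAt_form_comp (hη'.comp y h)
    (h.fderiv_right (m := ∞) (by simp))).congr_of_eventuallyEq (eventually_formAlong_eq η hψ)

/-- The exterior derivative is natural. -/
theorem formAlong_exteriorDeriv {k : ℕ} {η : DiffForm I N k} {ψ : W → N}
    {y : W} (hψ : ∀ᶠ z in 𝓝 y, ContMDiffAt 𝓘(ℝ, W) I ∞ ψ z) (hη : SmoothFormAt I η (ψ y)) :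
    formAlong I ψ (exteriorDeriv I η) y = extDeriv (formAlong I ψ η) y := by
  have h := contDiffAt_extChartAt_comp (mem_chart_source H (ψ y)) hψ.self_of_nhds
  have hη' : ContDiffAt ℝ ∞ (formInChart I η (ψ y)) ((extChartAt I (ψ y) ∘ ψ) y) := hη
  have h1 : formAlong I ψ η =ᶠ[𝓝 y] _ := eventually_formAlong_eq η hψ
  have h2 := extDeriv_pullback (hη'.differentiableAt (by simp)) h two_le_smoothness
  rw [h1.extDeriv_eq, h2]
  have h3 : fderiv ℝ (extChartAt I (ψ y) ∘ ψ) y =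
      (show E →L[ℝ] E from mfderiv I 𝓘(ℝ, E) (extChartAt I (ψ y)) (ψ y)).comp
        (derivAlong I ψ y) := by
    rw [← mfderiv_eq_fderiv]
    exact mfderiv_comp y (mdifferentiableAt_extChartAt (mem_chart_source H (ψ y)))
      (hψ.self_of_nhds.mdifferentiableAt (by simp))
  rw [h3]
  rfl

theorem contDiffAt_extDeriv [FiniteDimensional ℝ W] {k : ℕ} {η : W → W [⋀^Fin k]→L[ℝ] ℝ} {y : W}
    (hη : ContDiffAt ℝ ∞ η y) : ContDiffAt ℝ ∞ (extDeriv η) y := by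
  refine contDiffAt_form_of_apply fun v => ?_
  have h1 := hη.fderiv_right (m := ∞) (by simp)
  simp only [extDeriv, ContinuousAlternatingMap.alternatizeUncurryFin_apply]
  refine ContDiffAt.sum fun i _ => ?_
  exact (contDiffAt_form_apply (h1.clm_apply contDiffAt_const) fun _ => contDiffAt_const).const_smul _

/-- The tangent space at x is identified with E through the preferred chart at x itself, so that
chart has identity derivative there. -/
theorem derivAlong_extChartAt_symm_self (x : N) :
    derivAlong I (extChartAt I x).symm (extChartAt I x x) = .id ℝ E := by
  have := mfderivWithin_range_extChartAt_symm (I := I) (x := x)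
  rw [I.range_eq_univ, mfderivWithin_univ] at this
  exact this

theorem formInChart_self {k : ℕ} (η : DiffForm I N k) (x : N) :
    formInChart I η x (extChartAt I x x) = formValue I η x := by
  have h1 : (extChartAt I x).symm (extChartAt I x x) = x := extChartAt_to_inv x
  rw [formInChart_eq, formAlong, h1, derivAlong_extChartAt_symm_self]
  rfl

end Pullback

/-! ### The Poincaré and symplectic forms in adapted coordinates -/

section Symplectic
variable {d : ℕ} {M : Type*} [TopologicalSpace M] [ChartedSpace (Coord d) M]
  [IsManifold 𝓘(ℝ, Coord d) ∞ M]

/-- The metric in the preferred chart at `x₀`. -/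
def metricInChart (g : LorentzMetric d M) (x₀ : M) (x : Coord d) : Coord d →L[ℝ] Coord d →L[ℝ] ℝ :=
  (show Coord d →L[ℝ] Coord d →L[ℝ] ℝ from
    g.form ((extChartAt 𝓘(ℝ, Coord d) x₀).symm x)).bilinearComp
      (derivAlong 𝓘(ℝ, Coord d) (extChartAt 𝓘(ℝ, Coord d) x₀).symm x)
      (derivAlong 𝓘(ℝ, Coord d) (extChartAt 𝓘(ℝ, Coord d) x₀).symm x)

/-- The vector of components `p` at `x` in the preferred chart at `x₀`. -/
def liftInChart (x₀ : M) (x p : Coord d) : TM d M :=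
  ⟨(extChartAt 𝓘(ℝ, Coord d) x₀).symm x,
    derivAlong 𝓘(ℝ, Coord d) (extChartAt 𝓘(ℝ, Coord d) x₀).symm x p⟩

/-- The trivialisation of the tangent bundle at x₀ is the one induced by the chart at x₀. Through
it, bundle smoothness translates into coordinate smoothness. -/
theorem derivAlong_extChartAt_symm {x₀ : M} {x : Coord d}
    (hx : x ∈ (extChartAt 𝓘(ℝ, Coord d) x₀).target) (p : Coord d) :
    derivAlong 𝓘(ℝ, Coord d) (extChartAt 𝓘(ℝ, Coord d) x₀).symm x p =
    (trivializationAt (Coord d) (TangentSpace 𝓘(ℝ, Coord d) : M → Type _) x₀).symmL ℝ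
      ((extChartAt 𝓘(ℝ, Coord d) x₀).symm x) p := by
  have h1 : (extChartAt 𝓘(ℝ, Coord d) x₀).symm x ∈ (chartAt (Coord d) x₀).source := by
    rw [← extChartAt_source 𝓘(ℝ, Coord d)]
    exact (extChartAt 𝓘(ℝ, Coord d) x₀).map_target hx
  rw [TangentBundle.symmL_trivializationAt h1, ModelWithCorners.range_eq_univ, mfderivWithin_univ,
    (extChartAt 𝓘(ℝ, Coord d) x₀).right_inv hx]
  rfl

/-- A coordinate vector field with constant components p is constant in the trivialisation at x₀. -/
theorem contMDiffAt_liftInChart {x₀ : M} {x : Coord d}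
    (hx : x ∈ (extChartAt 𝓘(ℝ, Coord d) x₀).target) (p : Coord d) :
    ContMDiffAt 𝓘(ℝ, Coord d) (tangentModel d) ∞ (fun x => liftInChart x₀ x p) x := by
  let e := trivializationAt (Coord d) (TangentSpace 𝓘(ℝ, Coord d) : M → Type _) x₀
  have hb : ∀ x ∈ (extChartAt 𝓘(ℝ, Coord d) x₀).target,
      (extChartAt 𝓘(ℝ, Coord d) x₀).symm x ∈ e.baseSet := fun x hx => by
    rw [TangentBundle.trivializationAt_baseSet, ← extChartAt_source 𝓘(ℝ, Coord d)]
    exact (extChartAt 𝓘(ℝ, Coord d) x₀).map_target hx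
  rw [Bundle.Trivialization.contMDiffAt_iff (e := e)]
  · refine ⟨contMDiffAt_extChartAt_symm hx, ?_⟩
    refine (contMDiffAt_const (c := p)).congr_of_eventuallyEq ?_
    filter_upwards [(isOpen_extChartAt_target x₀).mem_nhds hx] with z hz
    have h1 : liftInChart x₀ z p = ⟨(extChartAt 𝓘(ℝ, Coord d) x₀).symm z, e.symmL ℝ _ p⟩ := by
      rw [liftInChart, derivAlong_extChartAt_symm hz]
    rw [h1]
    have := e.continuousLinearMapAt_symmL (R := ℝ) (hb z hz) p
    rw [Trivialization.continuousLinearMapAt_apply ℝ e, e.linearMapAt_apply, if_pos (hb z hz)] at this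
    exact this
  · rw [e.mem_source]
    exact hb x hx

theorem contDiffOn_metricInChart (g : LorentzMetric d M) (x₀ : M) :
    ContDiffOn ℝ ∞ (metricInChart g x₀) (extChartAt 𝓘(ℝ, Coord d) x₀).target := by
  rw [contDiffOn_clm_apply]
  intro p
  rw [contDiffOn_clm_apply]
  intro r x hx
  have : ContMDiffAt 𝓘(ℝ, Coord d) (𝓘(ℝ, Coord d).prod 𝓘(ℝ)) ∞
      (fun x => TotalSpace.mk' ℝ (E := Bundle.Trivial M ℝ) (liftInChart x₀ x p).proj
        (g.form (liftInChart x₀ x p).proj (liftInChart x₀ x p).snd (liftInChart x₀ x r).snd)) x := by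
    apply ContMDiffAt.clm_bundle_apply₂ (F₁ := Coord d) (F₂ := Coord d)
    · exact g.contMDiff.contMDiffAt.comp x (contMDiffAt_extChartAt_symm hx)
    · exact contMDiffAt_liftInChart hx p
    · exact contMDiffAt_liftInChart hx r
  rw [contMDiffAt_totalSpace] at this
  exact this.2.contDiffAt.contDiffWithinAt

theorem mem_target_of_mem_target {v : TM d M} {z : Coord d × Coord d}
    (hz : z ∈ (extChartAt (tangentModel d) v).target) :
    z.1 ∈ (extChartAt 𝓘(ℝ, Coord d) v.proj).target := by
  rw [FiberBundle.extChartAt_target] at hz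
  exact hz.1.1

/-- The preferred charts of the tangent bundle are the adapted coordinates (x, p). -/
theorem extChartAt_symm_eq_liftInChart {v : TM d M} {z : Coord d × Coord d}
    (hz : z ∈ (extChartAt (tangentModel d) v).target) :
    (extChartAt (tangentModel d) v).symm z = liftInChart v.proj z.1 z.2 := by
  have hz1 := mem_target_of_mem_target hz
  rw [FiberBundle.extChartAt_target] at hz
  rw [liftInChart, derivAlong_extChartAt_symm hz1, FiberBundle.extChartAt]
  rw [Trivialization.symmL_apply _ hz.1.2, Trivialization.mk_symm _ hz.1.2]
  rfl

theorem footpoint_comp_extChartAt_symm {v : TM d M} {z : Coord d × Coord d}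
    (hz : z ∈ (extChartAt (tangentModel d) v).target) :
    footpoint ∘ (extChartAt (tangentModel d) v).symm =ᶠ[𝓝 z]
      (extChartAt 𝓘(ℝ, Coord d) v.proj).symm ∘ Prod.fst := by
  filter_upwards [(isOpen_extChartAt_target v).mem_nhds hz] with u hu
  rw [Function.comp_apply, extChartAt_symm_eq_liftInChart hu]
  rfl

theorem contMDiff_footpoint :
    ContMDiff (tangentModel d) 𝓘(ℝ, Coord d) ∞ (footpoint : TM d M → M) :=
  contMDiff_proj _

variable {W : Type*} [NormedAddCommGroup W] [NormedSpace ℝ W]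

theorem derivAlong_footpoint_comp {ψ : W → TM d M} {y : W}
    (hψ : MDifferentiableAt 𝓘(ℝ, W) (tangentModel d) ψ y) :
    derivAlong 𝓘(ℝ, Coord d) (footpoint ∘ ψ) y =
      (show Coord d × Coord d →L[ℝ] Coord d from footpointDeriv (ψ y)).comp
        (derivAlong (tangentModel d) ψ y) :=
  mfderiv_comp y (contMDiff_footpoint.mdifferentiable (by simp) _) hψ

theorem formAlong_pullback_footpoint {k : ℕ} (F : DiffForm 𝓘(ℝ, Coord d) M k) {ψ : W → TM d M}
    {y : W} (hψ : MDifferentiableAt 𝓘(ℝ, W) (tangentModel d) ψ y) :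
    formAlong (tangentModel d) ψ (pullbackForm (tangentModel d) 𝓘(ℝ, Coord d) footpoint F) y =
      formAlong 𝓘(ℝ, Coord d) (footpoint ∘ ψ) F y := by
  rw [formAlong, formAlong, derivAlong_footpoint_comp hψ]
  rfl

/-- `Θ = g_ij p^i dx^j`. -/
theorem poincareForm_inChart (g : LorentzMetric d M) {v : TM d M} {z : Coord d × Coord d}
    (hz : z ∈ (extChartAt (tangentModel d) v).target) :
    formInChart (tangentModel d) (poincareForm g) v z =
      ContinuousAlternatingMap.ofSubsingleton ℝ (Coord d × Coord d) ℝ (0 : Fin 1)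
        ((metricInChart g v.proj z.1 z.2).comp (ContinuousLinearMap.fst ℝ _ _)) := by
  have h1 := (contMDiffAt_extChartAt_symm hz).mdifferentiableAt (by simp)
  have h2 := derivAlong_footpoint_comp h1
  have h3 : derivAlong 𝓘(ℝ, Coord d) (footpoint ∘ (extChartAt (tangentModel d) v).symm) z =
      (derivAlong 𝓘(ℝ, Coord d) (extChartAt 𝓘(ℝ, Coord d) v.proj).symm z.1).comp
        (ContinuousLinearMap.fst ℝ _ _) := by
    have h4 : derivAlong 𝓘(ℝ, Coord d) (footpoint ∘ (extChartAt (tangentModel d) v).symm) z =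
      derivAlong 𝓘(ℝ, Coord d) ((extChartAt 𝓘(ℝ, Coord d) v.proj).symm ∘ Prod.fst) z :=
      (footpoint_comp_extChartAt_symm hz).mfderiv_eq
    rw [h4, derivAlong_comp ((contMDiffAt_extChartAt_symm
      (mem_target_of_mem_target hz)).mdifferentiableAt (by simp)) differentiableAt_fst, fderiv_fst]
  ext w
  have h5 : ∀ u : TM d M, ∀ x, (g.form u.proj u.snd) ((footpointDeriv u) x) =
      (show Coord d →L[ℝ] Coord d →L[ℝ] ℝ from g.form u.proj) u.snd
        ((show Coord d × Coord d →L[ℝ] Coord d from footpointDeriv u) x) := fun _ _ => rfl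
  change g.form ((extChartAt (tangentModel d) v).symm z).proj
    ((extChartAt (tangentModel d) v).symm z).snd
    (((show Coord d × Coord d →L[ℝ] Coord d from
      footpointDeriv ((extChartAt (tangentModel d) v).symm z)).comp
        (derivAlong (tangentModel d) (extChartAt (tangentModel d) v).symm z)) (w 0)) = _
  rw [← h2, h3, extChartAt_symm_eq_liftInChart hz]
  rfl

theorem contDiffAt_metricInChart (g : LorentzMetric d M) {x₀ : M} {x : Coord d}
    (hx : x ∈ (extChartAt 𝓘(ℝ, Coord d) x₀).target) : ContDiffAt ℝ ∞ (metricInChart g x₀) x :=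
  (contDiffOn_metricInChart g x₀).contDiffAt ((isOpen_extChartAt_target x₀).mem_nhds hx)

theorem smoothFormAt_poincareForm (g : LorentzMetric d M) (v : TM d M) :
    SmoothFormAt (tangentModel d) (poincareForm g) v := by
  refine contDiffAt_form_of_apply fun w => ?_
  have hy := mem_extChartAt_target (I := tangentModel d) v
  have h1 : (fun z => formInChart (tangentModel d) (poincareForm g) v z w) =ᶠ[
      𝓝 (extChartAt (tangentModel d) v v)] fun z => metricInChart g v.proj z.1 z.2 (w 0).1 := by
    filter_upwards [(isOpen_extChartAt_target v).mem_nhds hy] with z hz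
    rw [poincareForm_inChart g hz]
    rfl
  refine ContDiffAt.congr_of_eventuallyEq ?_ h1
  refine ContDiffAt.clm_apply (ContDiffAt.clm_apply ?_ contDiffAt_snd) contDiffAt_const
  exact (contDiffAt_metricInChart g (mem_target_of_mem_target hy)).comp _ contDiffAt_fst

variable (g : LorentzMetric d M) (q : ℝ) (F : DiffForm 𝓘(ℝ, Coord d) M 2)

theorem formAlong_symplecticForm {ψ : W → TM d M} {y : W}
    (hψ : ∀ᶠ z in 𝓝 y, ContMDiffAt 𝓘(ℝ, W) (tangentModel d) ∞ ψ z) :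
    formAlong (tangentModel d) ψ (symplecticForm g q F) y =
      extDeriv (formAlong (tangentModel d) ψ (poincareForm g)) y +
        q • formAlong 𝓘(ℝ, Coord d) (footpoint ∘ ψ) F y := by
  rw [← formAlong_exteriorDeriv hψ (smoothFormAt_poincareForm g _),
    ← formAlong_pullback_footpoint F (hψ.self_of_nhds.mdifferentiableAt (by simp))]
  rfl

theorem contMDiffAt_footpoint_comp {ψ : W → TM d M} {y : W}
    (hψ : ∀ᶠ z in 𝓝 y, ContMDiffAt 𝓘(ℝ, W) (tangentModel d) ∞ ψ z) :
    ∀ᶠ z in 𝓝 y, ContMDiffAt 𝓘(ℝ, W) 𝓘(ℝ, Coord d) ∞ (footpoint ∘ ψ) z :=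
  hψ.mono fun z hz => contMDiff_footpoint.contMDiffAt.comp z hz

variable {F}

theorem contDiffAt_formAlong_symplecticForm [FiniteDimensional ℝ W]
    (hF : ∀ x, SmoothFormAt 𝓘(ℝ, Coord d) F x) {ψ : W → TM d M} {y : W}
    (hψ : ∀ᶠ z in 𝓝 y, ContMDiffAt 𝓘(ℝ, W) (tangentModel d) ∞ ψ z) :
    ContDiffAt ℝ ∞ (formAlong (tangentModel d) ψ (symplecticForm g q F)) y := by
  have h1 : ContDiffAt ℝ ∞ (fun z => extDeriv (formAlong (tangentModel d) ψ (poincareForm g)) z +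
        q • formAlong 𝓘(ℝ, Coord d) (footpoint ∘ ψ) F z) y :=
    (contDiffAt_extDeriv (contDiffAt_formAlong hψ (smoothFormAt_poincareForm g _))).add
      ((contDiffAt_formAlong (contMDiffAt_footpoint_comp hψ) (hF _)).const_smul q)
  exact h1.congr_of_eventuallyEq (hψ.eventually_nhds.mono fun z hz =>
    formAlong_symplecticForm g q F hz)

/-- ddΘ = 0, and dF = 0 is natural under the parametrisation followed by the projection. -/
theorem extDeriv_formAlong_symplecticForm [FiniteDimensional ℝ W] {ψ : W → TM d M} {y : W}
    (hF : ∀ x, SmoothFormAt 𝓘(ℝ, Coord d) F x) (hdF : exteriorDeriv 𝓘(ℝ, Coord d) F = 0)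
    (hψ : ∀ᶠ z in 𝓝 y, ContMDiffAt 𝓘(ℝ, W) (tangentModel d) ∞ ψ z) :
    extDeriv (formAlong (tangentModel d) ψ (symplecticForm g q F)) y = 0 := by
  have h1 : formAlong (tangentModel d) ψ (symplecticForm g q F) =ᶠ[𝓝 y]
      extDeriv (formAlong (tangentModel d) ψ (poincareForm g)) +
        q • formAlong 𝓘(ℝ, Coord d) (footpoint ∘ ψ) F :=
    hψ.eventually_nhds.mono fun z hz => formAlong_symplecticForm g q F hz
  have h2 := contDiffAt_formAlong hψ (smoothFormAt_poincareForm g _)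
  have h3 := contDiffAt_formAlong (contMDiffAt_footpoint_comp hψ) (hF _)
  have h4 := formAlong_exteriorDeriv (contMDiffAt_footpoint_comp hψ) (hF _)
  rw [hdF] at h4
  rw [h1.extDeriv_eq, extDeriv_add ((contDiffAt_extDeriv h2).differentiableAt (by simp))
    ((h3.differentiableAt (by simp)).const_smul q), extDeriv_extDeriv_apply h2 two_le_smoothness,
    extDeriv_smul, ← h4, zero_add]
  ext w
  exact mul_zero q

end Symplectic

/-! ### Pointwise linear algebra of the symplectic form -/

section PhaseForm
variable {V : Type*} [NormedAddCommGroup V] [NormedSpace ℝ V]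

instance instNormedAddCommGroupBilinear : NormedAddCommGroup (V →L[ℝ] V →L[ℝ] ℝ) :=
  ContinuousLinearMap.toNormedAddCommGroup

instance instNormedSpaceBilinear : NormedSpace ℝ (V →L[ℝ] V →L[ℝ] ℝ) :=
  ContinuousLinearMap.toNormedSpace

/-- The two-form `Ω = G(p, dx) - G(dx, p) + C` on `V × V`, in which the second factor is Lagrangian
and `G` is a pseudo-orthonormal pairing. -/
def IsPhaseForm (η : (V × V) [⋀^Fin 2]→L[ℝ] ℝ) {n : ℕ} (ε : Fin n → ℝ) : Prop :=
  ∃ (G : V →L[ℝ] V →L[ℝ] ℝ) (C : V → V → ℝ) (b : Module.Basis (Fin n) ℝ V),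
    (∀ i j, G (b i) (b j) = if i = j then ε i else 0) ∧ (∀ x y, C y x = -C x y) ∧
    (∀ x, C x 0 = 0) ∧
    ∀ X Y : V × V, η ![X, Y] = G X.2 Y.1 - G Y.2 X.1 + C X.1 Y.1

variable {η : (V × V) [⋀^Fin 2]→L[ℝ] ℝ} {n : ℕ} {ε : Fin n → ℝ}

/-- The vertical vectors (0, ε i b i) are half of a Darboux frame; the other half is (b i, u i),
with u i correcting for C. -/
theorem IsPhaseForm.wedgePow_ne_zero (h : IsPhaseForm η ε) (hε : ∀ i, ε i * ε i = 1) :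
    wedgePow η n ≠ 0 := by
  obtain ⟨G, C, b, hG, hC, hC0, hη⟩ := h
  have hC0' : ∀ x, C 0 x = 0 := fun x => by rw [hC x 0, hC0, neg_zero]
  let f : Fin n → V × V := fun i => (0, ε i • b i)
  -- Chosen so that G(u i, b j) = -C(b i, b j)/2: the two metric terms of η on the vectors (b i, u
  -- i) then add up to -C(b i, b j).
  let u : Fin n → V := fun i => ∑ j, (-(1 / 2) * C (b i) (b j) * ε j) • b j
  have hu : ∀ i j, G (u i) (b j) = -(1 / 2) * C (b i) (b j) := fun i j => by
    simp only [u, map_sum, map_smul, sum_apply, smul_apply,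
      hG, smul_eq_mul]
    rw [Finset.sum_eq_single j (fun k _ hk => by simp [hk]) (by simp), if_pos rfl, mul_assoc, hε,
      mul_one]
  refine wedgePow_ne_zero_of_darboux η f (fun i => (b i, u i)) ?_ ?_ ?_
  · intro i j; rw [hη]; simp [f, hC0]
  · intro i j
    rw [hη]
    simp only [hu]
    rw [hC (b i) (b j)]
    ring
  · intro i j
    rw [hη]
    simp only [f, map_zero, map_smul, smul_apply, hG, hC0', smul_eq_mul]
    by_cases hij : i = j
    · subst hij; simp [hε]
    · simp [hij]

/-- Pairing with the vertical vectors (0, b i) makes Y.1 vanish; C then drops out, and pairing with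
(b i, 0) makes Y.2 vanish. -/
theorem IsPhaseForm.nondegenerate (h : IsPhaseForm η ε) (hε : ∀ i, ε i * ε i = 1) {Y : V × V}
    (hY : ∀ X, η ![X, Y] = 0) : Y = 0 := by
  obtain ⟨G, C, b, hG, hC, hC0, hη⟩ := h
  have hC0' : ∀ x, C 0 x = 0 := fun x => by rw [hC x 0, hC0, neg_zero]
  have hε0 : ∀ i, ε i ≠ 0 := fun i h0 => by have := hε i; simp [h0] at this
  have h1 : Y.1 = 0 := by
    rw [← b.repr.map_eq_zero_iff]
    ext i
    have := hY (0, b i)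
    rw [hη] at this
    simp only [map_zero, hC0', sub_zero, add_zero] at this
    rw [← b.sum_repr Y.1] at this
    simp only [map_sum, map_smul, hG, smul_eq_mul] at this
    rw [Finset.sum_eq_single i (fun k _ hk => by simp [hk.symm]) (by simp), if_pos rfl] at this
    simpa [hε0] using this
  have h2 : Y.2 = 0 := by
    rw [← b.repr.map_eq_zero_iff]
    ext i
    have := hY (b i, 0)
    rw [hη, h1] at this
    simp only [map_zero, hC0, zero_sub, add_zero] at this
    rw [← b.sum_repr Y.2] at this
    simp only [map_sum, map_smul, sum_apply, smul_apply,
      hG, smul_eq_mul] at this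
    rw [Finset.sum_eq_single i (fun k _ hk => by simp [hk]) (by simp), if_pos rfl] at this
    simpa [hε0] using this
  exact Prod.ext h1 h2

end PhaseForm

/-! ### Inverting a nondegenerate two-form smoothly -/

section FlatMap
variable {W : Type*} [NormedAddCommGroup W] [NormedSpace ℝ W]

theorem isBilinearMap_flat (η : W [⋀^Fin 2]→L[ℝ] ℝ) :
    IsBilinearMap ℝ fun w u : W => η ![u, w] where
  add_left w w' u := by
    rw [form_swap, form_swap η u w, form_swap η u w']
    have h : η ![w + w', u] = η ![w, u] + η ![w', u] :=
      η.toAlternatingMap.toMultilinearMap.cons_add ![u] w w'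
    rw [h, neg_add]
  smul_left c w u := by
    rw [form_swap, form_swap η u w]
    have h : η ![c • w, u] = c • η ![w, u] :=
      η.toAlternatingMap.toMultilinearMap.cons_smul ![u] c w
    rw [h, smul_neg]
  add_right w u u' := η.toAlternatingMap.toMultilinearMap.cons_add ![w] u u'
  smul_right c w u := η.toAlternatingMap.toMultilinearMap.cons_smul ![w] c u

variable [FiniteDimensional ℝ W]

/-- The map `w ↦ η(·, w)`. -/
def flatMap (η : W [⋀^Fin 2]→L[ℝ] ℝ) : W →L[ℝ] W →L[ℝ] ℝ :=
  (isBilinearMap_flat η).toContinuousBilinearMap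

theorem exists_equiv_flatMap {η : W [⋀^Fin 2]→L[ℝ] ℝ} (h : ∀ Y, (∀ X, η ![X, Y] = 0) → Y = 0) :
    ∃ e : W ≃L[ℝ] (W →L[ℝ] ℝ), (e : W →L[ℝ] W →L[ℝ] ℝ) = flatMap η := by
  have hinj : Function.Injective (flatMap η).toLinearMap := by
    rw [← LinearMap.ker_eq_bot, LinearMap.ker_eq_bot']
    intro w hw
    exact h w fun X => congrArg (fun f : W →L[ℝ] ℝ => f X) hw
  have hdim : Module.finrank ℝ W = Module.finrank ℝ (W →L[ℝ] ℝ) := by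
    rw [← Subspace.dual_finrank_eq (K := ℝ) (V := W)]
    exact (LinearMap.toContinuousLinearMap (𝕜 := ℝ) (E := W) (F' := ℝ)).finrank_eq
  refine ⟨(LinearEquiv.ofInjectiveOfFinrankEq _ hinj hdim).toContinuousLinearEquiv, ?_⟩
  ext w u
  rfl

/-- Nondegeneracy forces L = (`flatMap` Ω)⁻¹ ℓ, and inversion is smooth at invertible operators.
Applied to the Liouville field, which is only defined implicitly. -/
theorem contDiffAt_of_form_eq {E : Type*} [NormedAddCommGroup E] [NormedSpace ℝ E]
    {Ω : E → W [⋀^Fin 2]→L[ℝ] ℝ} {y : E} (hΩ : ContDiffAt ℝ ∞ Ω y)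
    (hnd : ∀ᶠ z in 𝓝 y, ∀ Y, (∀ X, Ω z ![X, Y] = 0) → Y = 0) {L : E → W} {ℓ : W →L[ℝ] ℝ}
    (hL : ∀ᶠ z in 𝓝 y, ∀ u, Ω z ![u, L z] = ℓ u) : ContDiffAt ℝ ∞ L y := by
  have h1 : L =ᶠ[𝓝 y] fun z => (flatMap (Ω z)).inverse ℓ := by
    filter_upwards [hnd, hL] with z hz hLz
    obtain ⟨e, he⟩ := exists_equiv_flatMap hz
    have h2 : flatMap (Ω z) (L z) = ℓ := by ext u; exact hLz u
    rw [← h2, ← he, ContinuousLinearMap.inverse_equiv]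
    simp
  have h3 : ContDiffAt ℝ ∞ (fun z => flatMap (Ω z)) y := by
    have := finiteDimensional_form W 2
    let c : (W [⋀^Fin 2]→L[ℝ] ℝ) →L[ℝ] W →L[ℝ] W →L[ℝ] ℝ := LinearMap.toContinuousLinearMap
      { toFun := flatMap
        map_add' := fun _ _ => rfl
        map_smul' := fun _ _ => rfl }
    have hc : ContDiff ℝ ∞ c := by apply ContinuousLinearMap.contDiff
    exact hc.contDiffAt.comp y hΩ
  obtain ⟨e, he⟩ := exists_equiv_flatMap hnd.self_of_nhds
  have h5 : ContDiffAt ℝ ∞ ContinuousLinearMap.inverse (flatMap (Ω y)) := by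
    rw [← he]
    exact contDiffAt_map_inverse e
  exact ((h5.comp y h3).clm_apply contDiffAt_const).congr_of_eventuallyEq h1

end FlatMap

/-! ### The symplectic form at a point -/

section Structure
variable {d : ℕ} {M : Type*} [TopologicalSpace M] [ChartedSpace (Coord d) M]
  [IsManifold 𝓘(ℝ, Coord d) ∞ M]

theorem extChartAt_tangent_fst (v : TM d M) :
    (extChartAt (tangentModel d) v v).1 = extChartAt 𝓘(ℝ, Coord d) v.proj v.proj := by
  rw [FiberBundle.extChartAt]
  rfl

/-- In Θ = G_x(p, dx), differentiating p gives the two metric terms and differentiating the metric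
gives terms seeing X and Y only through their horizontal parts. -/
theorem extDeriv_poincareForm (g : LorentzMetric d M) (v : TM d M) (X Y : Coord d × Coord d) :
    extDeriv (formInChart (tangentModel d) (poincareForm g) v)
      (extChartAt (tangentModel d) v v) ![X, Y] =
    metricInChart g v.proj (extChartAt (tangentModel d) v v).1 X.2 Y.1 -
      metricInChart g v.proj (extChartAt (tangentModel d) v v).1 Y.2 X.1 +
    (fderiv ℝ (metricInChart g v.proj) (extChartAt (tangentModel d) v v).1 X.1
      (extChartAt (tangentModel d) v v).2 Y.1 -
    fderiv ℝ (metricInChart g v.proj) (extChartAt (tangentModel d) v v).1 Y.1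
      (extChartAt (tangentModel d) v v).2 X.1) := by
  set y := extChartAt (tangentModel d) v v with hy
  have hyt : y ∈ (extChartAt (tangentModel d) v).target := mem_extChartAt_target v
  have hsm : ContDiffAt ℝ ∞ (formInChart (tangentModel d) (poincareForm g) v) y :=
    smoothFormAt_poincareForm g v
  have hG := ((contDiffAt_metricInChart g (mem_target_of_mem_target hyt)).differentiableAt
    (by simp)).hasFDerivAt
  have h1 : ∀ (w : Fin 1 → Coord d × Coord d) (Z : Coord d × Coord d),
      fderiv ℝ (fun z => formInChart (tangentModel d) (poincareForm g) v z w) y Z =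
      fderiv ℝ (metricInChart g v.proj) y.1 Z.1 y.2 (w 0).1 +
        metricInChart g v.proj y.1 Z.2 (w 0).1 := by
    intro w Z
    have h2 : (fun z => formInChart (tangentModel d) (poincareForm g) v z w) =ᶠ[𝓝 y]
        fun z => metricInChart g v.proj z.1 z.2 (w 0).1 := by
      filter_upwards [(isOpen_extChartAt_target v).mem_nhds hyt] with z hz
      rw [poincareForm_inChart g hz]
      rfl
    have h3 := ((hG.comp y hasFDerivAt_fst).clm_apply hasFDerivAt_snd).clm_apply
      (hasFDerivAt_const (w 0).1 y)
    rw [(h3.congr_of_eventuallyEq h2).fderiv]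
    simp
    ring
  rw [extDeriv_apply (hsm.differentiableAt (by simp)), Fin.sum_univ_two, h1, h1]
  have e0 : (0 : Fin 2).removeNth ![X, Y] = ![Y] := by ext1 i; fin_cases i; rfl
  have e1 : (1 : Fin 2).removeNth ![X, Y] = ![X] := by ext1 i; fin_cases i; rfl
  rw [e0, e1]
  simp
  ring

/-- The signs of a Lorentz metric. -/
def lorentzSign {d : ℕ} (i : Fin (d + 1)) : ℝ := if i = 0 then -1 else 1

theorem lorentzSign_mul_self {d : ℕ} (i : Fin (d + 1)) : lorentzSign i * lorentzSign i = 1 := by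
  unfold lorentzSign; split_ifs <;> norm_num

/-- The derivatives of the metric and the external field q F both go into C, being antisymmetric in
the horizontal parts; the basis is the pseudo-orthonormal one of the signature. -/
theorem isPhaseForm_symplecticForm (g : LorentzMetric d M) (q : ℝ)
    (F : DiffForm 𝓘(ℝ, Coord d) M 2) (v : TM d M) :
    IsPhaseForm (formValue (tangentModel d) (symplecticForm g q F) v)
      (lorentzSign (d := d)) := by
  set y := extChartAt (tangentModel d) v v with hy
  have hyt : y ∈ (extChartAt (tangentModel d) v).target := mem_extChartAt_target v
  have hψ : ∀ᶠ z in 𝓝 y, ContMDiffAt 𝓘(ℝ, Coord d × Coord d) (tangentModel d) ∞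
      (extChartAt (tangentModel d) v).symm z := by
    filter_upwards [(isOpen_extChartAt_target v).mem_nhds hyt] with z hz
    exact contMDiffAt_extChartAt_symm hz
  have hφ := (contMDiffAt_extChartAt_symm (mem_target_of_mem_target hyt)).mdifferentiableAt
    (I := 𝓘(ℝ, Coord d)) (by simp)
  have h1 := formAlong_symplecticForm g q F hψ
  rw [formAlong_congr F (footpoint_comp_extChartAt_symm hyt),
    formAlong_comp F hφ differentiableAt_fst, fderiv_fst, ← formInChart_eq, ← formInChart_eq,
    formInChart_self] at h1
  obtain ⟨b, hb⟩ := g.signature v.proj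
  have hG : metricInChart g v.proj y.1 = g.form v.proj := by
    have h2 : (extChartAt 𝓘(ℝ, Coord d) v.proj).symm (extChartAt 𝓘(ℝ, Coord d) v.proj v.proj) =
      v.proj := extChartAt_to_inv _
    rw [hy, extChartAt_tangent_fst, metricInChart, derivAlong_extChartAt_symm_self, h2]
    rfl
  let C : Coord d → Coord d → ℝ := fun a b => fderiv ℝ (metricInChart g v.proj) y.1 a y.2 b -
    fderiv ℝ (metricInChart g v.proj) y.1 b y.2 a + q * formAlong 𝓘(ℝ, Coord d)
      (extChartAt 𝓘(ℝ, Coord d) v.proj).symm F y.1 ![a, b]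
  refine ⟨metricInChart g v.proj y.1, C, b, ?_, ?_, ?_, ?_⟩
  · intro i j
    rw [hG]
    exact hb i j
  · intro a b
    simp only [C]
    rw [form_swap _ b a]
    ring
  · intro a
    simp only [C, map_zero, zero_apply]
    rw [ContinuousAlternatingMap.map_coord_zero _ 1 (by rfl)]
    simp
  · intro X Y
    rw [h1]
    have h3 := extDeriv_poincareForm g v X Y
    rw [← hy] at h3
    change extDeriv (formInChart (tangentModel d) (poincareForm g) v) y ![X, Y] + q * formAlong 𝓘(ℝ, Coord d)
      (extChartAt 𝓘(ℝ, Coord d) v.proj).symm F y.1 (fun i => (![X, Y] i).1) = _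
    have h4 : (fun i => (![X, Y] i).1) = ![X.1, Y.1] := by ext1 i; fin_cases i <;> rfl
    rw [h3, h4]
    simp only [C]
    ring

end Structure

/-! ### Existence of σ from the Euler field -/

section ShellFactor
variable {d : ℕ} {M : Type*} [TopologicalSpace M] [ChartedSpace (Coord d) M]
  [IsManifold 𝓘(ℝ, Coord d) ∞ M]

/-- The curve `t ↦ (x, (1 + t) p)`. -/
def eulerCurve (v : TM d M) (t : ℝ) : TM d M := ⟨v.proj, (1 + t) • v.snd⟩

/-- The Euler vector field `p ∂/∂p`. -/
def eulerField (v : TM d M) : Coord d × Coord d := derivAlong (tangentModel d) (eulerCurve v) 0 1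

theorem eulerCurve_inChart {v : TM d M} {z : Coord d × Coord d}
    (hz : z ∈ (extChartAt (tangentModel d) v).target) :
    eulerCurve ((extChartAt (tangentModel d) v).symm z) =
      (extChartAt (tangentModel d) v).symm ∘ fun t : ℝ => (z.1, (1 + t) • z.2) := by
  have h1 : ∀ t : ℝ, (z.1, (1 + t) • z.2) ∈ (extChartAt (tangentModel d) v).target := fun t => by
    rw [FiberBundle.extChartAt_target] at hz ⊢
    exact ⟨hz.1, trivial⟩
  ext1 t
  rw [Function.comp_apply, extChartAt_symm_eq_liftInChart (h1 t),
    extChartAt_symm_eq_liftInChart hz]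
  simp only [liftInChart, map_smul]
  rfl

theorem hasDerivAt_eulerLine (z : Coord d × Coord d) :
    HasDerivAt (fun t : ℝ => (z.1, (1 + t) • z.2)) (0, z.2) 0 := by
  have := (((hasDerivAt_id (0 : ℝ)).const_add 1).smul_const z.2)
  simpa using (hasDerivAt_const (0 : ℝ) z.1).prodMk this

theorem eulerField_inChart {v : TM d M} {z : Coord d × Coord d}
    (hz : z ∈ (extChartAt (tangentModel d) v).target) :
    eulerField ((extChartAt (tangentModel d) v).symm z) =
      derivAlong (tangentModel d) (extChartAt (tangentModel d) v).symm z (0, z.2) := by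
  have h3 := hasDerivAt_eulerLine z
  have h4 : ((z.1, (1 + (0 : ℝ)) • z.2) : Coord d × Coord d) = z := by simp
  have h5 := (contMDiffAt_extChartAt_symm hz).mdifferentiableAt (by simp)
  rw [eulerField, eulerCurve_inChart hz, derivAlong_comp (by rw [h4]; exact h5)
    h3.differentiableAt, h4]
  simp [h3.hasFDerivAt.fderiv]

theorem mdifferentiableAt_eulerCurve (v : TM d M) :
    MDifferentiableAt 𝓘(ℝ, ℝ) (tangentModel d) (eulerCurve v) 0 := by
  have hvt := mem_extChartAt_target (I := tangentModel d) v
  have h0 : (extChartAt (tangentModel d) v).symm (extChartAt (tangentModel d) v v) = v :=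
    extChartAt_to_inv v
  have h1 := eulerCurve_inChart hvt
  rw [h0] at h1
  rw [h1]
  set y := extChartAt (tangentModel d) v v
  have h4 : ((y.1, (1 + (0 : ℝ)) • y.2) : Coord d × Coord d) = y := by simp
  refine MDifferentiableAt.comp (0 : ℝ) (I' := 𝓘(ℝ, Coord d × Coord d)) ?_
    (hasDerivAt_eulerLine y).differentiableAt.mdifferentiableAt
  rw [h4]
  exact (contMDiffAt_extChartAt_symm hvt).mdifferentiableAt (by simp)

/-- The differential, as a functional on the model space. -/
def diffValue (f : TM d M → ℝ) (v : TM d M) : Coord d × Coord d →L[ℝ] ℝ :=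
  differential (tangentModel d) f v

variable {W : Type*} [NormedAddCommGroup W] [NormedSpace ℝ W]

theorem fderiv_hamiltonian_comp (g : LorentzMetric d M) {ψ : W → TM d M} {y : W}
    (hψ : MDifferentiableAt 𝓘(ℝ, W) (tangentModel d) ψ y) :
    fderiv ℝ (hamiltonian g ∘ ψ) y =
      (diffValue (hamiltonian g) (ψ y)).comp (derivAlong (tangentModel d) ψ y) := by
  rw [← mfderiv_eq_fderiv]
  exact mfderiv_comp y ((contMDiff_hamiltonian g).mdifferentiable (by simp) _) hψ

/-- Euler's identity: H is homogeneous of degree 2 in p. -/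
theorem diffValue_eulerField (g : LorentzMetric d M) (v : TM d M) :
    diffValue (hamiltonian g) v (eulerField v) = 2 * hamiltonian g v := by
  have h4 : hamiltonian g ∘ eulerCurve v = fun t => (1 + t) ^ 2 * hamiltonian g v := by
    ext t
    change 1 / 2 * g.form v.proj ((1 + t) • v.snd) ((1 + t) • v.snd) =
      (1 + t) ^ 2 * (1 / 2 * g.form v.proj v.snd v.snd)
    rw [map_smul, map_smul, smul_apply, smul_eq_mul, smul_eq_mul]
    ring
  have h5 : HasDerivAt (fun t : ℝ => (1 + t) ^ 2 * hamiltonian g v) (2 * hamiltonian g v) 0 := by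
    have := (((hasDerivAt_id (0 : ℝ)).const_add 1).pow 2).mul_const (hamiltonian g v)
    simpa using this
  have h6 := fderiv_hamiltonian_comp g (mdifferentiableAt_eulerCurve v)
  rw [h4, h5.hasFDerivAt.fderiv] at h6
  have h7 : eulerCurve v 0 = v := by simp [eulerCurve]
  have h8 := congrArg (fun f : ℝ →L[ℝ] ℝ => f 1) h6
  rw [h7] at h8
  rw [eulerField]
  simpa using h8.symm

theorem formAlong_phaseVolume (g : LorentzMetric d M) (q : ℝ) (F : DiffForm 𝓘(ℝ, Coord d) M 2)
    (ψ : W → TM d M) (y : W) :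
    formAlong (tangentModel d) ψ (phaseVolume g q F) y =
      ((-1 : ℝ) ^ ((d + 1) * d / 2) / (d + 1).factorial) •
        wedgePow (formAlong (tangentModel d) ψ (symplecticForm g q F) y) (d + 1) := by
  ext w
  have h : formAlong (tangentModel d) ψ (symplecticForm g q F) y =
    (formValue (tangentModel d) (symplecticForm g q F) (ψ y)).compContinuousLinearMap
      (derivAlong (tangentModel d) ψ y) := rfl
  rw [h, ContinuousAlternatingMap.smul_apply, wedgePow_comp]
  rfl

theorem phaseVolume_coeff_ne_zero (d : ℕ) :
    (-1 : ℝ) ^ ((d + 1) * d / 2) / (d + 1).factorial ≠ 0 :=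
  div_ne_zero (pow_ne_zero _ (by norm_num)) (by positivity)

/-- The contraction of `Λ` with `(2H)⁻¹ p ∂/∂p`. -/
def contractedVolume (g : LorentzMetric d M) (q : ℝ) (F : DiffForm 𝓘(ℝ, Coord d) M 2) :
    DiffForm (tangentModel d) (TM d M) (2 * d + 1) := fun v =>
  -- The degrees 2 * (d + 1) and 2 * d + 1 + 1 agree by definition, which exposes a first slot to
  -- contract.
  (show (Coord d × Coord d) [⋀^Fin (2 * d + 1 + 1)]→L[ℝ] ℝ from
    formValue (tangentModel d) (phaseVolume g q F) v).curryLeft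
      ((2 * hamiltonian g v)⁻¹ • eulerField v)

/-- On V the contracting field Y = (2H)⁻¹ p ∂/∂p is smooth, as H ≠ 0, and satisfies dH(Y) = 1, so dH
∧ ι_Y Λ = Λ in top degree. -/
theorem isShellFactor_contractedVolume (g : LorentzMetric d M) (q : ℝ)
    {F : DiffForm 𝓘(ℝ, Coord d) M 2} (hF : ∀ x, SmoothFormAt 𝓘(ℝ, Coord d) F x) :
    IsShellFactor g q F (contractedVolume g q F) where
  smooth v hv := by
    refine contDiffAt_form_of_apply fun w => ?_
    set y := extChartAt (tangentModel d) v v with hy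
    have hyt : y ∈ (extChartAt (tangentModel d) v).target := mem_extChartAt_target v
    have hψ : ∀ᶠ z in 𝓝 y, ContMDiffAt 𝓘(ℝ, Coord d × Coord d) (tangentModel d) ∞
        (extChartAt (tangentModel d) v).symm z := by
      filter_upwards [(isOpen_extChartAt_target v).mem_nhds hyt] with z hz
      exact contMDiffAt_extChartAt_symm hz
    let μ : Coord d × Coord d → (Coord d × Coord d) [⋀^Fin (2 * d + 1 + 1)]→L[ℝ] ℝ :=
      formAlong (tangentModel d) (extChartAt (tangentModel d) v).symm (phaseVolume g q F)
    have hμ : ContDiffAt ℝ ∞ μ y := by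
      have : μ = fun z => _ := funext fun z => formAlong_phaseVolume g q F _ z
      rw [this]
      exact (contDiffAt_wedgePow (contDiffAt_formAlong_symplecticForm g q hF hψ) _).const_smul _
    let h : Coord d × Coord d → ℝ := hamiltonian g ∘ (extChartAt (tangentModel d) v).symm
    have hh : ContDiffAt ℝ ∞ h y :=
      (((contMDiff_hamiltonian g).contMDiffAt).comp y hψ.self_of_nhds).contDiffAt
    have hh0 : h y ≠ 0 := by
      have : h y = hamiltonian g v := congrArg (hamiltonian g) (extChartAt_to_inv v)
      rw [this]
      exact hv.ne
    let X : Fin (2 * d + 1 + 1) → Coord d × Coord d → Coord d × Coord d :=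
      Fin.cons (fun z => (2 * h z)⁻¹ • (0, z.2)) fun i _ => w i
    have hX : ∀ i, ContDiffAt ℝ ∞ (X i) y := fun i => by
      refine Fin.cases ?_ (fun j => ?_) i
      · exact ((contDiffAt_const.mul hh).inv (mul_ne_zero two_ne_zero hh0)).smul
          (contDiffAt_const.prodMk contDiffAt_snd)
      · exact contDiffAt_const
    refine (contDiffAt_form_apply hμ hX).congr_of_eventuallyEq ?_
    filter_upwards [(isOpen_extChartAt_target v).mem_nhds hyt] with z hz
    change formValue (tangentModel d) (phaseVolume g q F) ((extChartAt (tangentModel d) v).symm z)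
      (Matrix.vecCons ((2 * h z)⁻¹ • eulerField ((extChartAt (tangentModel d) v).symm z))
        fun i => derivAlong (tangentModel d) (extChartAt (tangentModel d) v).symm z (w i)) =
      formValue (tangentModel d) (phaseVolume g q F) ((extChartAt (tangentModel d) v).symm z)
        fun i => derivAlong (tangentModel d) (extChartAt (tangentModel d) v).symm z (X i z)
    rw [eulerField_inChart hz, ← map_smul]
    congr 1
    ext1 i
    refine Fin.cases ?_ (fun j => ?_) i
    · rfl
    · rfl
  wedge_eq v hv X := by
    have h1 : (diffValue (hamiltonian g) v) ((2 * hamiltonian g v)⁻¹ • eulerField v) = 1 := by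
      rw [map_smul, diffValue_eulerField, smul_eq_mul, inv_mul_cancel₀]
      exact mul_ne_zero two_ne_zero hv.ne
    exact wedge_oneForm_interior (V := Coord d × Coord d) MassShell.finrank_model
      (diffValue (hamiltonian g) v) _ h1 (contractedVolume g q F v)
      (formValue (tangentModel d) (phaseVolume g q F) v) (fun w => rfl) X

end ShellFactor

/-! ### The Liouville field and Λ in straightened coordinates -/

section Shell
variable {d : ℕ} {M : Type*} [TopologicalSpace M] [ChartedSpace (Coord d) M]
  [IsManifold 𝓘(ℝ, Coord d) ∞ M]

/-- The model space of the mass shell. -/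
abbrev ShellCoord (d : ℕ) : Type := EuclideanSpace ℝ (Fin (2 * d + 1))

/-- The Liouville vector field, as a function to the model space. -/
def liouvilleValue (g : LorentzMetric d M) (q : ℝ) (F : DiffForm 𝓘(ℝ, Coord d) M 2) (v : TM d M) :
    Coord d × Coord d := liouvilleField g q F v

/-- Nondegeneracy of Ω_s supplies a solution, so the choice made by `Classical.epsilon` is one. -/
theorem liouvilleValue_spec (g : LorentzMetric d M) (q : ℝ) (F : DiffForm 𝓘(ℝ, Coord d) M 2)
    (v : TM d M) (u : Coord d × Coord d) :
    formValue (tangentModel d) (symplecticForm g q F) v ![u, liouvilleValue g q F v] =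
      diffValue (hamiltonian g) v u := by
  obtain ⟨e, he⟩ := exists_equiv_flatMap (η := formValue (tangentModel d) (symplecticForm g q F) v)
    fun Y hY => (isPhaseForm_symplecticForm g q F v).nondegenerate lorentzSign_mul_self hY
  have h1 : ∃ w : TangentSpace (tangentModel d) v, ∀ u : TangentSpace (tangentModel d) v,
      differential (tangentModel d) (hamiltonian g) v u = symplecticForm g q F v ![u, w] := by
    refine ⟨(e.symm (diffValue (hamiltonian g) v) : Coord d × Coord d), fun u => ?_⟩
    have h2 : flatMap (formValue (tangentModel d) (symplecticForm g q F) v)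
        (e.symm (diffValue (hamiltonian g) v)) = diffValue (hamiltonian g) v := by
      rw [← he]; simp
    exact (congrArg (fun f : Coord d × Coord d →L[ℝ] ℝ => f u) h2).symm
  exact (Classical.epsilon_spec h1 u).symm

section Straightening
variable (g : LorentzMetric d M) (q : ℝ) (F : DiffForm 𝓘(ℝ, Coord d) M 2)
  {Φ : OpenPartialHomeomorph (TM d M) (ℝ × ShellCoord d)}
  {z : ℝ × ShellCoord d}

theorem IsStraightening.contMDiffAt_symm (hΦ : IsStraightening (tangentModel d) (hamiltonian g) Φ)
    (hz : z ∈ Φ.target) :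
    ContMDiffAt 𝓘(ℝ, ℝ × ShellCoord d) (tangentModel d) ∞ Φ.symm z :=
  hΦ.contMDiffOn_symm.contMDiffAt (Φ.open_target.mem_nhds hz)

theorem IsStraightening.eventually_contMDiffAt_symm
    (hΦ : IsStraightening (tangentModel d) (hamiltonian g) Φ) (hz : z ∈ Φ.target) :
    ∀ᶠ y in 𝓝 z, ContMDiffAt 𝓘(ℝ, ℝ × ShellCoord d) (tangentModel d) ∞ Φ.symm y := by
  filter_upwards [Φ.open_target.mem_nhds hz] with y hy
  exact hΦ.contMDiffAt_symm g hy

theorem IsStraightening.hamiltonian_symm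
    (hΦ : IsStraightening (tangentModel d) (hamiltonian g) Φ) (hz : z ∈ Φ.target) :
    hamiltonian g (Φ.symm z) = z.1 := by
  rw [← hΦ.fst_eq _ (Φ.map_target hz), Φ.right_inv hz]

theorem IsStraightening.diffValue_derivAlong
    (hΦ : IsStraightening (tangentModel d) (hamiltonian g) Φ) (hz : z ∈ Φ.target)
    (w : ℝ × ShellCoord d) :
    diffValue (hamiltonian g) (Φ.symm z) (derivAlong (tangentModel d) Φ.symm z w) = w.1 := by
  have h1 := fderiv_hamiltonian_comp g ((hΦ.contMDiffAt_symm g hz).mdifferentiableAt (by simp))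
  have h2 : hamiltonian g ∘ Φ.symm =ᶠ[𝓝 z] Prod.fst := by
    filter_upwards [Φ.open_target.mem_nhds hz] with y hy
    exact hΦ.hamiltonian_symm g hy
  rw [h2.fderiv_eq, fderiv_fst] at h1
  exact (congrArg (fun f : ℝ × ShellCoord d →L[ℝ] ℝ => f w) h1).symm

/-- The derivative of Φ is a left inverse by the chain rule, and the dimensions agree. -/
theorem IsStraightening.exists_equiv_derivAlong
    (hΦ : IsStraightening (tangentModel d) (hamiltonian g) Φ) (hz : z ∈ Φ.target) :
    ∃ e : (ℝ × ShellCoord d) ≃L[ℝ] (Coord d × Coord d),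
      (e : (ℝ × ShellCoord d) →L[ℝ] (Coord d × Coord d)) = derivAlong (tangentModel d) Φ.symm z := by
  have h1 : MDifferentiableAt (tangentModel d) 𝓘(ℝ, ℝ × ShellCoord d) Φ (Φ.symm z) :=
    (hΦ.contMDiffOn.contMDiffAt (Φ.open_source.mem_nhds (Φ.map_target hz))).mdifferentiableAt
      (by simp)
  have h2 := (hΦ.contMDiffAt_symm g hz).mdifferentiableAt (by simp)
  have h3 : Φ ∘ Φ.symm =ᶠ[𝓝 z] id := by
    filter_upwards [Φ.open_target.mem_nhds hz] with y hy
    exact Φ.right_inv hy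
  have h4 : (show Coord d × Coord d →L[ℝ] ℝ × ShellCoord d from
      mfderiv (tangentModel d) 𝓘(ℝ, ℝ × ShellCoord d) Φ (Φ.symm z)).comp
      (derivAlong (tangentModel d) Φ.symm z) = .id ℝ _ := by
    have h5 := mfderiv_comp z h1 h2
    rw [h3.mfderiv_eq, mfderiv_id] at h5
    exact h5.symm
  have hinj : Function.Injective (derivAlong (tangentModel d) Φ.symm z).toLinearMap := by
    intro a b hab
    have h6 := congrArg (fun x : Coord d × Coord d => (show Coord d × Coord d →L[ℝ] ℝ × ShellCoord d
      from mfderiv (tangentModel d) 𝓘(ℝ, ℝ × ShellCoord d) Φ (Φ.symm z)) x) hab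
    have h7 := fun c => congrArg (fun f : ℝ × ShellCoord d →L[ℝ] ℝ × ShellCoord d => f c) h4
    exact (h7 a).symm.trans (h6.trans (h7 b))
  refine ⟨(LinearEquiv.ofInjectiveOfFinrankEq _ hinj ?_).toContinuousLinearEquiv, ?_⟩
  · rw [MassShell.finrank_model]; simp [add_comm]
  · ext w <;> rfl

/-- The Liouville vector field in straightened coordinates. -/
def liouvilleAlong (Φ : OpenPartialHomeomorph (TM d M) (ℝ × ShellCoord d)) (z : ℝ × ShellCoord d) :
    ℝ × ShellCoord d :=
  (derivAlong (tangentModel d) Φ.symm z).inverse (liouvilleValue g q F (Φ.symm z))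

theorem IsStraightening.derivAlong_liouvilleAlong
    (hΦ : IsStraightening (tangentModel d) (hamiltonian g) Φ) (hz : z ∈ Φ.target) :
    derivAlong (tangentModel d) Φ.symm z (liouvilleAlong g q F Φ z) =
      liouvilleValue g q F (Φ.symm z) := by
  obtain ⟨e, he⟩ := hΦ.exists_equiv_derivAlong g hz
  rw [liouvilleAlong, ← he, ContinuousLinearMap.inverse_equiv]
  simp

/-- H is the first coordinate here, so Ω_s(·, L) is a constant covector; this is the form needed to
differentiate the equation and to solve it smoothly. -/
theorem IsStraightening.symplectic_liouvilleAlong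
    (hΦ : IsStraightening (tangentModel d) (hamiltonian g) Φ) (hz : z ∈ Φ.target)
    (u : ℝ × ShellCoord d) :
    formAlong (tangentModel d) Φ.symm (symplecticForm g q F) z ![u, liouvilleAlong g q F Φ z] =
      u.1 := by
  rw [← hΦ.diffValue_derivAlong g hz u, ← liouvilleValue_spec g q F,
    ← hΦ.derivAlong_liouvilleAlong g q F hz]
  change formValue (tangentModel d) (symplecticForm g q F) (Φ.symm z)
    (derivAlong (tangentModel d) Φ.symm z ∘ ![u, liouvilleAlong g q F Φ z]) = _
  congr 1
  ext1 i
  fin_cases i <;> rfl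

theorem IsStraightening.liouvilleAlong_fst
    (hΦ : IsStraightening (tangentModel d) (hamiltonian g) Φ) (hz : z ∈ Φ.target) :
    (liouvilleAlong g q F Φ z).1 = 0 := by
  rw [← hΦ.symplectic_liouvilleAlong g q F hz]
  have := form_swap (formAlong (tangentModel d) Φ.symm (symplecticForm g q F) z)
    (liouvilleAlong g q F Φ z) (liouvilleAlong g q F Φ z)
  linarith

theorem IsStraightening.symplectic_nondegenerate
    (hΦ : IsStraightening (tangentModel d) (hamiltonian g) Φ) (hz : z ∈ Φ.target)
    (Y : ℝ × ShellCoord d)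
    (hY : ∀ X, formAlong (tangentModel d) Φ.symm (symplecticForm g q F) z ![X, Y] = 0) :
    Y = 0 := by
  obtain ⟨e, he⟩ := hΦ.exists_equiv_derivAlong g hz
  have h1 : e Y = 0 := by
    refine (isPhaseForm_symplecticForm g q F (Φ.symm z)).nondegenerate lorentzSign_mul_self
      fun X => ?_
    rw [← hY (e.symm X)]
    change _ = formValue (tangentModel d) (symplecticForm g q F) (Φ.symm z)
      (derivAlong (tangentModel d) Φ.symm z ∘ ![e.symm X, Y])
    rw [← he]
    congr 1
    ext1 i
    fin_cases i
    · exact (e.apply_symm_apply X).symm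
    · rfl
  simpa using h1

variable {F}

theorem IsStraightening.contDiffAt_symplecticForm (hF : ∀ x, SmoothFormAt 𝓘(ℝ, Coord d) F x)
    (hΦ : IsStraightening (tangentModel d) (hamiltonian g) Φ) (hz : z ∈ Φ.target) :
    ContDiffAt ℝ ∞ (formAlong (tangentModel d) Φ.symm (symplecticForm g q F)) z :=
  contDiffAt_formAlong_symplecticForm g q hF (hΦ.eventually_contMDiffAt_symm g hz)

theorem IsStraightening.contDiffAt_liouvilleAlong (hF : ∀ x, SmoothFormAt 𝓘(ℝ, Coord d) F x)
    (hΦ : IsStraightening (tangentModel d) (hamiltonian g) Φ) (hz : z ∈ Φ.target) :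
    ContDiffAt ℝ ∞ (liouvilleAlong g q F Φ) z := by
  refine contDiffAt_of_form_eq (hΦ.contDiffAt_symplecticForm g q hF hz) (ℓ := .fst ℝ _ _) ?_ ?_
  · filter_upwards [Φ.open_target.mem_nhds hz] with y hy
    exact hΦ.symplectic_nondegenerate g q F hy
  · filter_upwards [Φ.open_target.mem_nhds hz] with y hy
    exact hΦ.symplectic_liouvilleAlong g q F hy

/-- The volume form `Λ` in straightened coordinates. -/
def volumeAlong (q : ℝ) (F : DiffForm 𝓘(ℝ, Coord d) M 2)
    (Φ : OpenPartialHomeomorph (TM d M) (ℝ × ShellCoord d)) (z : ℝ × ShellCoord d) :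
    (ℝ × ShellCoord d) [⋀^Fin (2 * d + 1 + 1)]→L[ℝ] ℝ :=
  formAlong (tangentModel d) Φ.symm (phaseVolume g q F) z

theorem IsStraightening.contDiffAt_volumeAlong (hF : ∀ x, SmoothFormAt 𝓘(ℝ, Coord d) F x)
    (hΦ : IsStraightening (tangentModel d) (hamiltonian g) Φ) (hz : z ∈ Φ.target) :
    ContDiffAt ℝ ∞ (volumeAlong g q F Φ) z := by
  have : volumeAlong g q F Φ = fun z => _ := funext fun z => formAlong_phaseVolume g q F _ z
  rw [this]
  exact (contDiffAt_wedgePow (hΦ.contDiffAt_symplecticForm g q hF hz) _).const_smul _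

/-- Transport back by the invertible derivative of the parametrisation reduces this to the Darboux
frame at the point. -/
theorem IsStraightening.volumeAlong_ne_zero
    (hΦ : IsStraightening (tangentModel d) (hamiltonian g) Φ) (hz : z ∈ Φ.target) :
    volumeAlong g q F Φ z ≠ 0 := by
  obtain ⟨e, he⟩ := hΦ.exists_equiv_derivAlong g hz
  intro h
  refine (isPhaseForm_symplecticForm g q F (Φ.symm z)).wedgePow_ne_zero lorentzSign_mul_self ?_
  ext w
  have h1 : formAlong (tangentModel d) Φ.symm (phaseVolume g q F) z (fun i => e.symm (w i)) = 0 :=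
    congrArg (fun μ : (ℝ × ShellCoord d) [⋀^Fin (2 * d + 1 + 1)]→L[ℝ] ℝ =>
      μ fun i => e.symm (w i)) h
  rw [formAlong_phaseVolume, ContinuousAlternatingMap.smul_apply] at h1
  have h2 := (smul_eq_zero.1 h1).resolve_left (phaseVolume_coeff_ne_zero d)
  have h3 : formAlong (tangentModel d) Φ.symm (symplecticForm g q F) z =
    (formValue (tangentModel d) (symplecticForm g q F) (Φ.symm z)).compContinuousLinearMap
      (derivAlong (tangentModel d) Φ.symm z) := rfl
  rw [h3, wedgePow_comp, ← he] at h2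
  simpa using h2

theorem IsStraightening.hasDerivAt_volumeAlong (hF : ∀ x, SmoothFormAt 𝓘(ℝ, Coord d) F x)
    (hdF : exteriorDeriv 𝓘(ℝ, Coord d) F = 0)
    (hΦ : IsStraightening (tangentModel d) (hamiltonian g) Φ) (hz : z ∈ Φ.target)
    (v : Fin (2 * d + 1 + 1) → ℝ × ShellCoord d) :
    HasDerivAt (fun t : ℝ => volumeAlong g q F Φ (z + t • liouvilleAlong g q F Φ z)
      fun i => v i + t • fderiv ℝ (liouvilleAlong g q F Φ) z (v i)) 0 0 := by
  have h1 := hasDerivAt_closed_form_curve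
    ((hΦ.contDiffAt_symplecticForm g q hF hz).differentiableAt (by simp))
    (extDeriv_formAlong_symplecticForm g q hF hdF (hΦ.eventually_contMDiffAt_symm g hz))
    ((hΦ.contDiffAt_liouvilleAlong g q hF hz).differentiableAt (by simp)) (ℓ := Prod.fst)
    (by
      filter_upwards [Φ.open_target.mem_nhds hz] with y hy
      exact hΦ.symplectic_liouvilleAlong g q F hy)
  have h2 := (hasDerivAt_wedgePow_curve h1 (d + 1) v).const_mul
    ((-1 : ℝ) ^ ((d + 1) * d / 2) / (d + 1).factorial)
  rw [mul_zero] at h2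
  refine h2.congr_of_eventuallyEq (Eventually.of_forall fun t => ?_)
  exact congrArg (fun μ : (ℝ × ShellCoord d) [⋀^Fin (2 * (d + 1))]→L[ℝ] ℝ =>
    μ fun i => v i + t • fderiv ℝ (liouvilleAlong g q F Φ) z (v i))
    (formAlong_phaseVolume g q F Φ.symm (z + t • liouvilleAlong g q F Φ z))

/-- On the slices `σ` is the contraction of `Λ` with the first coordinate vector. -/
theorem IsShellFactor.formAlong_slice {σ : DiffForm (tangentModel d) (TM d M) (2 * d + 1)}
    (hσ : IsShellFactor g q F σ) (hΦ : IsStraightening (tangentModel d) (hamiltonian g) Φ)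
    (hz : z ∈ Φ.target) (hz1 : z.1 < 0) (w : Fin (2 * d + 1) → ShellCoord d) :
    formAlong (tangentModel d) Φ.symm σ z (fun i => (0, w i)) =
      volumeAlong g q F Φ z (Fin.cons ((1, 0) : ℝ × ShellCoord d) fun i => (0, w i)) := by
  let D := derivAlong (tangentModel d) Φ.symm z
  let X : Fin (2 * d + 1 + 1) → ℝ × ShellCoord d := Fin.cons (1, 0) fun i => (0, w i)
  let c : Fin (1 + (2 * d + 1)) → Fin (2 * d + 1 + 1) := Fin.cast (by omega)
  have hc : ∀ i, c (Fin.natAdd 1 i) = Fin.succ i := fun i => by ext; simp [c]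
  -- Test dH ∧ σ = Λ on the images of ∂_h and of slice vectors: dH is 1 on the first and 0 on the
  -- others, so the wedge collapses to σ.
  have h1 := hσ.wedge_eq (Φ.symm z) (by rw [hΦ.hamiltonian_symm g hz]; exact hz1)
    (fun i => D (X (c i)))
  have h2 := wedge_oneForm_apply (V := Coord d × Coord d) (diffValue (hamiltonian g) (Φ.symm z))
    (formValue (tangentModel d) σ (Φ.symm z)) (fun i => D (X (c i))) (fun i => by
      rw [hΦ.diffValue_derivAlong g hz, hc]; rfl)
  have h3 := h2.symm.trans h1
  rw [hΦ.diffValue_derivAlong g hz] at h3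
  have h4 : (X (c (Fin.castAdd (2 * d + 1) 0))).1 = 1 := rfl
  rw [h4, one_mul] at h3
  simp only [hc] at h3
  exact h3

end Straightening
end Shell

/-! ### The mass shell in its slice charts -/

section MassShellCharts
variable {d : ℕ} {M : Type*} [TopologicalSpace M] [ChartedSpace (Coord d) M]
  [IsManifold 𝓘(ℝ, Coord d) ∞ M]
variable (g : LorentzMetric d M) {m : ℝ} [Fact (0 < m)]

namespace MassShell

/-- The straightening that defines the preferred chart at `s`. -/
def straightening (s : MassShell g m) :
    OpenPartialHomeomorph (TM d M) (ℝ × ShellCoord d) :=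
  (exists_straightening (tangentModel d) finrank_model (contMDiff_hamiltonian g)
    (regular g m s.1 s.2)).choose

theorem isStraightening (s : MassShell g m) :
    IsStraightening (tangentModel d) (hamiltonian g) (straightening g s) :=
  (exists_straightening (tangentModel d) finrank_model (contMDiff_hamiltonian g)
    (regular g m s.1 s.2)).choose_spec.1

theorem chartAt_eq (s : MassShell g m) :
    chartAt (ShellCoord d) s = levelChart s (straightening g s) (isStraightening g s) := rfl

theorem extChartAt_symm_eq (s : MassShell g m) (x : ShellCoord d) :
    (extChartAt (shellModel d) s).symm x =
      (levelChart s (straightening g s) (isStraightening g s)).symm x := by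
  simp only [mfld_simps]
  rw [chartAt_eq]
  rfl

theorem mem_extChartAt_target_iff (s : MassShell g m) (x : ShellCoord d) :
    x ∈ (extChartAt (shellModel d) s).target ↔ (-m ^ 2 / 2, x) ∈ (straightening g s).target := by
  simp only [mfld_simps]
  rw [chartAt_eq]
  rfl

theorem incl_extChartAt_symm (s : MassShell g m) {x : ShellCoord d}
    (hx : x ∈ (extChartAt (shellModel d) s).target) :
    incl g m ((extChartAt (shellModel d) s).symm x) =
      (straightening g s).symm (-m ^ 2 / 2, x) := by
  rw [mem_extChartAt_target_iff] at hx
  rw [extChartAt_symm_eq]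
  have h : hamiltonian g ((straightening g s).symm (-m ^ 2 / 2, x)) = -m ^ 2 / 2 :=
    (isStraightening g s).hamiltonian_symm g hx
  -- On the target the inverse of `levelChart` takes its first branch, so the default point does not
  -- enter.
  exact congrArg Subtype.val (dif_pos h)

theorem contMDiff_incl : ContMDiff (shellModel d) (tangentModel d) ∞ (incl g m) := by
  intro s
  have hst : extChartAt (shellModel d) s s ∈ (extChartAt (shellModel d) s).target :=
    mem_extChartAt_target s
  have h1 : ContMDiffAt (shellModel d) 𝓘(ℝ, ShellCoord d) ∞ (extChartAt (shellModel d) s) s :=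
    contMDiffAt_extChartAt
  have h2 : ContMDiffAt 𝓘(ℝ, ShellCoord d) 𝓘(ℝ, ℝ × ShellCoord d) ∞
      (fun x : ShellCoord d => ((-m ^ 2 / 2, x) : ℝ × ShellCoord d))
      (extChartAt (shellModel d) s s) :=
    ContDiffAt.contMDiffAt (by fun_prop)
  have h3 := (isStraightening g s).contMDiffAt_symm g
    ((mem_extChartAt_target_iff g s _).1 hst)
  refine ((h3.comp _ h2).comp s h1).congr_of_eventuallyEq ?_
  filter_upwards [extChartAt_source_mem_nhds (I := shellModel d) s] with t ht
  have h4 := incl_extChartAt_symm g s ((extChartAt (shellModel d) s).map_source ht)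
  rw [(extChartAt (shellModel d) s).left_inv ht] at h4
  exact h4

/-- In these charts the inclusion is x ↦ (-m²/2, x), with derivative w ↦ (0, w). -/
theorem derivAlong_incl (s : MassShell g m) {x : ShellCoord d}
    (hx : x ∈ (extChartAt (shellModel d) s).target) (w : ShellCoord d) :
    (show ShellCoord d →L[ℝ] Coord d × Coord d from mfderiv (shellModel d) (tangentModel d)
      (incl g m) ((extChartAt (shellModel d) s).symm x))
        (derivAlong (shellModel d) (extChartAt (shellModel d) s).symm x w) =
      derivAlong (tangentModel d) (straightening g s).symm (-m ^ 2 / 2, x) (0, w) := by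
  have h1 : incl g m ∘ (extChartAt (shellModel d) s).symm =ᶠ[𝓝 x]
      (straightening g s).symm ∘ fun x => (-m ^ 2 / 2, x) := by
    filter_upwards [(isOpen_extChartAt_target s).mem_nhds hx] with y hy
    exact incl_extChartAt_symm g s hy
  have h2 : derivAlong (tangentModel d) (incl g m ∘ (extChartAt (shellModel d) s).symm) x =
      (show ShellCoord d →L[ℝ] Coord d × Coord d from mfderiv (shellModel d) (tangentModel d)
      (incl g m) ((extChartAt (shellModel d) s).symm x)).comp
        (derivAlong (shellModel d) (extChartAt (shellModel d) s).symm x) :=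
    mfderiv_comp x ((contMDiff_incl g).mdifferentiable (by simp) _)
      ((contMDiffAt_extChartAt_symm hx).mdifferentiableAt (by simp))
  have h3 : derivAlong (tangentModel d) (incl g m ∘ (extChartAt (shellModel d) s).symm) x =
    derivAlong (tangentModel d) ((straightening g s).symm ∘ fun x => (-m ^ 2 / 2, x)) x :=
    h1.mfderiv_eq
  have h4 : HasFDerivAt (fun x : ShellCoord d => (-m ^ 2 / 2, x))
    (ContinuousLinearMap.inr ℝ ℝ (ShellCoord d)) x := hasFDerivAt_prodMk_right _ x
  rw [h2, derivAlong_comp (((isStraightening g s).contMDiffAt_symm g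
    ((mem_extChartAt_target_iff g s x).1 hx)).mdifferentiableAt (by simp)) h4.differentiableAt,
    h4.fderiv] at h3
  exact congrArg (fun f : ShellCoord d →L[ℝ] Coord d × Coord d => f w) h3

variable (q : ℝ) {F : DiffForm 𝓘(ℝ, Coord d) M 2}

/-- The right-hand side does not contain σ: every factor induces the same Ω. Smoothness,
nonvanishing and invariance of Ω are all deduced from this formula. -/
theorem formInChart_shellForm {σ : DiffForm (tangentModel d) (TM d M) (2 * d + 1)}
    (hσ : IsShellFactor g q F σ) (s : MassShell g m) {x : ShellCoord d}
    (hx : x ∈ (extChartAt (shellModel d) s).target) (w : Fin (2 * d + 1) → ShellCoord d) :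
    formInChart (shellModel d) (shellForm g m σ) s x w =
      volumeAlong g q F (straightening g s) (-m ^ 2 / 2, x)
        (Fin.cons ((1, 0) : ℝ × ShellCoord d) fun i => (0, w i)) := by
  have hm : -m ^ 2 / 2 < 0 := by
    have : 0 < m ^ 2 := pow_pos (Fact.out : 0 < m) 2
    linarith
  rw [← hσ.formAlong_slice g q (isStraightening g s) ((mem_extChartAt_target_iff g s x).1 hx) hm]
  change formValue (tangentModel d) σ (incl g m ((extChartAt (shellModel d) s).symm x))
    (fun i => (show ShellCoord d →L[ℝ] Coord d × Coord d from
      mfderiv (shellModel d) (tangentModel d)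
      (incl g m) ((extChartAt (shellModel d) s).symm x))
        (derivAlong (shellModel d) (extChartAt (shellModel d) s).symm x (w i))) =
    formValue (tangentModel d) σ ((straightening g s).symm (-m ^ 2 / 2, x))
      fun i => derivAlong (tangentModel d) (straightening g s).symm (-m ^ 2 / 2, x) (0, w i)
  simp only [derivAlong_incl g s hx]
  rw [incl_extChartAt_symm g s hx]

theorem smoothFormAt_shellForm (hF : ∀ x, SmoothFormAt 𝓘(ℝ, Coord d) F x)
    {σ : DiffForm (tangentModel d) (TM d M) (2 * d + 1)}
    (hσ : IsShellFactor g q F σ) (s : MassShell g m) :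
    SmoothFormAt (shellModel d) (shellForm g m σ) s := by
  refine contDiffAt_form_of_apply fun w => ?_
  have hst := mem_extChartAt_target (I := shellModel d) s
  have h1 : (fun x => formInChart (shellModel d) (shellForm g m σ) s x w) =ᶠ[
      𝓝 (extChartAt (shellModel d) s s)] fun x =>
        volumeAlong g q F (straightening g s) (-m ^ 2 / 2, x)
          (Fin.cons ((1, 0) : ℝ × ShellCoord d) fun i => (0, w i)) := by
    filter_upwards [(isOpen_extChartAt_target s).mem_nhds hst] with x hx
    exact formInChart_shellForm g q hσ s hx w
  refine ContDiffAt.congr_of_eventuallyEq ?_ h1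
  refine contDiffAt_form_apply (v := fun i _ => (Fin.cons ((1, 0) : ℝ × ShellCoord d)
    (fun i => (0, w i)) : Fin (2 * d + 1 + 1) → ℝ × ShellCoord d) i) ?_ fun _ => contDiffAt_const
  exact ((isStraightening g s).contDiffAt_volumeAlong g q hF
    ((mem_extChartAt_target_iff g s _).1 hst)).comp _ (contDiffAt_const.prodMk contDiffAt_id)

/-- Otherwise Λ would vanish on a basis made of ∂_h and slice vectors, hence identically at that
point. -/
theorem shellForm_ne_zero {σ : DiffForm (tangentModel d) (TM d M) (2 * d + 1)}
    (hσ : IsShellFactor g q F σ) (s : MassShell g m) : shellForm g m σ s ≠ 0 := by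
  intro h0
  have hst := mem_extChartAt_target (I := shellModel d) s
  have h1 : formValue (shellModel d) (shellForm g m σ) s = 0 := h0
  rw [← formInChart_self] at h1
  obtain ⟨B, w, hw, hB⟩ := exists_basis_cons (V := ℝ × ShellCoord d) (k := 2 * d + 1)
    (by simp [add_comm]) (LinearMap.fst ℝ ℝ (ShellCoord d)) (1, 0) rfl
  have h2 : w = fun i => (0, (w i).2) := funext fun i => Prod.ext (hw i) rfl
  have h3 := formInChart_shellForm g q hσ s hst fun i => (w i).2
  rw [h1, ← h2, ← hB] at h3
  refine (isStraightening g s).volumeAlong_ne_zero (F := F) g q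
    ((mem_extChartAt_target_iff g s _).1 hst) ?_
  apply ContinuousAlternatingMap.toAlternatingMap_injective
  rw [AlternatingMap.eq_smul_basis_det B (ContinuousAlternatingMap.toAlternatingMap _)]
  change volumeAlong g q F (straightening g s) _ B • B.det = 0
  rw [← h3]
  exact zero_smul _ _

/-- Since L has no ∂_h component, its slice part gives a vector with ι_* w = L; injectivity of ι_*
makes it the one chosen by `Classical.epsilon`. -/
theorem fieldInChart_shellField (s : MassShell g m) {x : ShellCoord d}
    (hx : x ∈ (extChartAt (shellModel d) s).target) :
    fieldInChart (shellModel d) (shellField g m q F) s x =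
      (liouvilleAlong g q F (straightening g s) (-m ^ 2 / 2, x)).2 := by
  have hz := (mem_extChartAt_target_iff g s x).1 hx
  have hΦ := isStraightening g s
  set p := (extChartAt (shellModel d) s).symm x with hp
  set y := liouvilleAlong g q F (straightening g s) (-m ^ 2 / 2, x) with hy
  have hy0 : y = (0, y.2) := Prod.ext (hΦ.liouvilleAlong_fst g q F hz) rfl
  let ι' : ShellCoord d →L[ℝ] Coord d × Coord d :=
    mfderiv (shellModel d) (tangentModel d) (incl g m) p
  let D := derivAlong (shellModel d) (extChartAt (shellModel d) s).symm x
  have h1 : ι' (D y.2) = liouvilleValue g q F (incl g m p) := by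
    have h2 := derivAlong_incl g s hx y.2
    rw [← hy0, hΦ.derivAlong_liouvilleAlong g q F hz, ← incl_extChartAt_symm g s hx] at h2
    exact h2
  have h3 : ι' (shellField g m q F p) = liouvilleValue g q F (incl g m p) :=
    Classical.epsilon_spec (p := fun w : ShellCoord d =>
      ι' w = liouvilleValue g q F (incl g m p)) ⟨D y.2, h1⟩
  -- `fieldInChart` applies the `inverse` of D, which is zero by default; invertibility makes it the
  -- true inverse.
  have hinv : D.IsInvertible := by
    have := isInvertible_mfderivWithin_extChartAt_symm (I := shellModel d) hx
    rw [ModelWithCorners.range_eq_univ, mfderivWithin_univ] at this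
    exact this
  obtain ⟨e, he⟩ := hinv
  have h4 : D.inverse (shellField g m q F p) = y.2 := by
    obtain ⟨e', he'⟩ := hΦ.exists_equiv_derivAlong g hz
    have h5 : ∀ w, D w = e w := fun w => by rw [← he]; rfl
    have h6 := derivAlong_incl g s hx (e.symm (shellField g m q F p))
    have h7 : D (e.symm (shellField g m q F p)) = shellField g m q F p := by
      rw [h5]; exact e.apply_symm_apply _
    have h8 : ι' (D (e.symm (shellField g m q F p))) = ι' (D y.2) := by rw [h7, h3, h1]
    have h9 := derivAlong_incl g s hx y.2
    have h10 : e' (0, e.symm (shellField g m q F p)) = e' (0, y.2) := by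
      have := h6.symm.trans (h8.trans h9)
      rw [← he'] at this
      exact this
    have h11 := congrArg Prod.snd (e'.injective h10)
    rw [← he, ContinuousLinearMap.inverse_equiv]
    exact h11
  exact h4

theorem lieDeriv_shellForm (hF : ∀ x, SmoothFormAt 𝓘(ℝ, Coord d) F x)
    (hdF : exteriorDeriv 𝓘(ℝ, Coord d) F = 0)
    {σ : DiffForm (tangentModel d) (TM d M) (2 * d + 1)}
    (hσ : IsShellFactor g q F σ) (s : MassShell g m) :
    lieDeriv (shellModel d) (shellField g m q F) (shellForm g m σ) s = 0 := by
  have hst := mem_extChartAt_target (I := shellModel d) s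
  have hz := (mem_extChartAt_target_iff g s _).1 hst
  have hΦ := isStraightening g s
  have hnhds := (isOpen_extChartAt_target (I := shellModel d) s).mem_nhds hst
  have hsm : ContDiffAt ℝ ∞ (formInChart (shellModel d) (shellForm g m σ) s)
    (extChartAt (shellModel d) s s) := smoothFormAt_shellForm g q hF hσ s
  have h1 := lieDeriv_slice_eq_zero (G := ShellCoord d) (k := 2 * d + 1) (by simp)
    (μ := volumeAlong g q F (straightening g s))
    ((hΦ.contDiffAt_liouvilleAlong g q hF hz).differentiableAt (by simp))
    (by
      filter_upwards [(straightening g s).open_target.mem_nhds hz] with y hy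
      exact hΦ.liouvilleAlong_fst g q F hy)
    (hΦ.hasDerivAt_volumeAlong g q hF hdF hz)
    (hsm.differentiableAt (by simp))
    (by
      filter_upwards [hnhds] with x hx
      exact formInChart_shellForm g q hσ s hx)
    (X := fieldInChart (shellModel d) (shellField g m q F) s)
    (by
      filter_upwards [hnhds] with x hx
      exact fieldInChart_shellField g q s hx)
  -- The Lie derivative is the pull-back by the chart derivative of the coordinate expression just
  -- shown to vanish.
  exact congrArg (fun μ : ShellCoord d [⋀^Fin (2 * d + 1)]→L[ℝ] ℝ =>
    μ.compContinuousLinearMap (show ShellCoord d →L[ℝ] ShellCoord d from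
      mfderiv (shellModel d) 𝓘(ℝ, ShellCoord d) (extChartAt (shellModel d) s) s)) h1

end MassShell
end MassShellCharts

/-- The number 0 satisfies the defining equation, so the chosen number does too, and η x ≠ 0 leaves
no other. -/
theorem divergence_eq_zero {E : Type*} [NormedAddCommGroup E] [NormedSpace ℝ E] {H : Type*}
    [TopologicalSpace H] (I : ModelWithCorners ℝ E H) {N : Type*} [TopologicalSpace N]
    [ChartedSpace H N] {k : ℕ} {X : ∀ x : N, TangentSpace I x} {η : DiffForm I N k} {x : N}
    (hη : η x ≠ 0) (h : lieDeriv I X η x = 0) : divergence I X η x = 0 := by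
  have h1 : lieDeriv I X η x = divergence I X η x • η x :=
    Classical.epsilon_spec (p := fun c : ℝ => lieDeriv I X η x = c • η x) ⟨0, by rw [h, zero_smul]⟩
  rw [h] at h1
  exact (smul_eq_zero.1 h1.symm).resolve_right hη

end RelativisticKinetic
end

theorem mainTheorem2 {d : ℕ} {M : Type*} [TopologicalSpace M] [ChartedSpace (Coord d) M]
    [IsManifold 𝓘(ℝ, Coord d) ∞ M] (g : LorentzMetric d M)
    (q : ℝ) (F : DiffForm 𝓘(ℝ, Coord d) M 2)
    (hF : ∀ x, SmoothFormAt 𝓘(ℝ, Coord d) F x) (hdF : exteriorDeriv 𝓘(ℝ, Coord d) F = 0)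
    (m : ℝ) [Fact (0 < m)] :
    (∃ σ, IsShellFactor g q F σ) ∧
    ∀ σ, IsShellFactor g q F σ →
      IsVolumeForm (shellModel d) (shellForm g m σ) ∧
      (∀ s, lieDeriv (shellModel d) (shellField g m q F) (shellForm g m σ) s =
        divergence (shellModel d) (shellField g m q F) (shellForm g m σ) s • shellForm g m σ s) ∧
      lieDeriv (shellModel d) (shellField g m q F) (shellForm g m σ) = 0 ∧
      divergence (shellModel d) (shellField g m q F) (shellForm g m σ) = 0 := by
  refine ⟨⟨_, isShellFactor_contractedVolume g q hF⟩, fun σ hσ => ?_⟩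
  have h0 := MassShell.shellForm_ne_zero (m := m) g q hσ
  have h1 := MassShell.lieDeriv_shellForm (m := m) g q hF hdF hσ
  have h2 := fun s => divergence_eq_zero (shellModel d) (h0 s) (h1 s)
  exact ⟨fun s => ⟨MassShell.smoothFormAt_shellForm g q hF hσ s, h0 s⟩,
    fun s => by rw [h1, h2, zero_smul], funext h1, funext h2⟩
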